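/- **Setting.** For $x=(a,b)\in\mathbb F_2^{2n}$ let $W_x=i^{a'\cdot b'}(X^{a_1}Z^{b_1})\otimes\cdots\otimes(X^{a_n}Z^{b_n})$, where $a',b'\in\{0,1\}^n\subset\mathbb Z^n$ lift $a,b$. For an $n$-qubit pure state $|\psi\rangle$, the *stabilizer dimension* is the dimension of the subspace $\{x\in\mathbb F_2^{2n}: W_x|\psi\rangle=\pm|\psi\rangle\}$ of $\mathbb F_2^{2n}$; the *fidelity* of $|\psi\rangle,|\varphi\rangle$ is $|\langle\psi|\varphi\rangle|^2$; $p_\psi(x)=2^{-n}\langle\psi|W_x|\psi\rangle^2$ and $q_\psi(x)=\sum_{a\in\mathbb F_2^{2n}}p_\psi(a)\,p_\psi(x+a)$. *Bell difference sampling* measures two pairs of copies of $|\psi\rangle$ (four copies in all) in the Bell basis $|\Phi_x\rangle=(W_x\otimes I)\,2^{-n/2}\sum_s|s\rangle|s\rangle$, $x\in\mathbb F_2^{2n}$, and outputs the sum in $\mathbb F_2^{2n}$ of the two outcomes. **Algorithm.** Input: integers $1\le k\le n$, reals $\varepsilon\in(0,3/8)$, $\delta\in(0,1]$, and copies of an $n$-qubit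 pure state $|\psi\rangle$. Draw $m=\left\lfloor\frac{2\log(1/\delta)+8n}{\varepsilon}\right\rfloor$ Bell difference samples, let $S\subseteq\mathbb F_2^{2n}$ be their span and $\hat k=2n-\dim S$. Return $1$ if $\hat k\ge k$ and $0$ otherwise. **Theorem.** For all such $n,k,\varepsilon,\delta$ and every $n$-qubit pure state $|\psi\rangle$: 1. The $m$ Bell difference samples are independent, each distributed according to $q_\psi$. 2. If $|\psi\rangle$ has stabilizer dimension at least $k$, the algorithm returns $1$ with probability $1$. 3. If $|\psi\rangle$ has fidelity at most $1-\varepsilon$ with every $n$-qubit pure state of stabilizer dimension at least $k$, the algorithm returns $0$ with probability at least $1-\delta$. In particular, promised that one of the two cases holds, the algorithm decides which one with probability at least $1-\delta$. Moreover, there are one fixed program, which receives $n$, $k$ and $m$ as inputs, and a universal constant $C$ such that, whatever the measurement outcomes are, the program carries out the algorithm using $4m\le\frac{32n+8\log(1/\delta)}{\varepsilon}$ copies of $|\psi\rangle$ and at most $C\cdot\frac{n^3+n^2\log(1/\delta)}{\varepsilon}$ steps. Here programs run on a machine with counters (clear, copy, change by one, compare), a random access memory of bits addressed by pairs of counters (assign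 a bit, add one bit to another modulo 2, test a bit), and a Bell measurement of two fresh copies of $|\psi\rangle$ that stores the $2n$ outcome bits; every instruction costs one step, except that a Bell measurement of two copies costs $2n+1$ steps. -/

import Mathlib

open Matrix

namespace StabTest

/-! ### States, Weyl operators, stabilizer dimension -/

/-- The space `(ℂ²)^{⊗ n}` of `n` qubits, with the computational basis indexed by bit strings.
A pure state is a vector of norm one. -/
abbrev Qubits (n : ℕ) : Type := EuclideanSpace ℂ (Fin n → Fin 2)

/-- The phase space `𝔽₂^{2n}`; its elements are written `x = (a, b)`. -/
abbrev Phase (n : ℕ) : Type := (Fin n → ZMod 2) × (Fin n → ZMod 2)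

/-- The Pauli matrix `X`. -/
def pauliX : Matrix (Fin 2) (Fin 2) ℂ := !![0, 1; 1, 0]

/-- The Pauli matrix `Z`. -/
def pauliZ : Matrix (Fin 2) (Fin 2) ℂ := !![1, 0; 0, -1]

/-- The Weyl operator `W_x = i^{a'·b'} (X^{a₁} Z^{b₁}) ⊗ ⋯ ⊗ (X^{aₙ} Z^{bₙ})` for `x = (a, b)`, where
`a', b'` are the lifts of `a, b` to integer vectors with entries in `{0, 1}`. -/
noncomputable def weyl {n : ℕ} (x : Phase n) : Matrix (Fin n → Fin 2) (Fin n → Fin 2) ℂ :=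
  Matrix.of fun s t =>
    Complex.I ^ (∑ j, (x.1 j).val * (x.2 j).val) *
      ∏ j, (pauliX ^ (x.1 j).val * pauliZ ^ (x.2 j).val) (s j) (t j)

/-- The vector `W_x |ψ⟩`. -/
noncomputable def weylApply {n : ℕ} (x : Phase n) (ψ : Qubits n) : Qubits n :=
  Matrix.toEuclideanLin (weyl x) ψ

/-- The unsigned stabilizer group `Weyl(|ψ⟩) = {x : W_x |ψ⟩ = ± |ψ⟩}`. -/
def weylGroup {n : ℕ} (ψ : Qubits n) : Set (Phase n) :=
  {x | weylApply x ψ = ψ ∨ weylApply x ψ = -ψ}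

/-- The stabilizer dimension of a state: the dimension over `𝔽₂` of `Weyl(|ψ⟩)`. For a state `ψ` the
set `Weyl(|ψ⟩)` is a linear subspace, so that it equals its span. -/
noncomputable def stabDim {n : ℕ} (ψ : Qubits n) : ℕ :=
  Module.finrank (ZMod 2) (Submodule.span (ZMod 2) (weylGroup ψ))

/-- The fidelity `|⟨ψ|φ⟩|²` of two pure states. -/
noncomputable def fidelity {n : ℕ} (ψ φ : Qubits n) : ℝ := ‖inner ℂ ψ φ‖ ^ 2

/-- The characteristic distribution `p_ψ(x) = 2^{-n} ⟨ψ|W_x|ψ⟩²`. The number `⟨ψ|W_x|ψ⟩` is real since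
`W_x` is Hermitian, so its square is the square of its modulus. -/
noncomputable def charDist {n : ℕ} (ψ : Qubits n) (x : Phase n) : ℝ :=
  ‖inner ℂ ψ (weylApply x ψ)‖ ^ 2 / 2 ^ n

/-- The distribution `q_ψ(x) = ∑ₐ p_ψ(a) p_ψ(x + a)`. -/
noncomputable def bellDiffDist {n : ℕ} (ψ : Qubits n) (x : Phase n) : ℝ :=
  ∑ a, charDist ψ a * charDist ψ (x + a)

/-! ### Bell measurements -/

/-- The product state `|ψ⟩|φ⟩` of two `n`-qubit registers. -/
noncomputable def tensor {n : ℕ} (ψ φ : Qubits n) :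
    EuclideanSpace ℂ ((Fin n → Fin 2) × (Fin n → Fin 2)) :=
  WithLp.toLp 2 fun p => ψ p.1 * φ p.2

/-- The Bell basis of two `n`-qubit registers: `|Φ_x⟩ = (W_x ⊗ I) 2^{-n/2} ∑ₛ |s⟩|s⟩`. Up to a phase
this is the product over `j` of the two-qubit Bell states
`(X^{a_j} Z^{b_j} ⊗ I) (|00⟩ + |11⟩)/√2` of the `j`-th qubits of both registers. -/
noncomputable def bellState {n : ℕ} (x : Phase n) :
    EuclideanSpace ℂ ((Fin n → Fin 2) × (Fin n → Fin 2)) :=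
  WithLp.toLp 2 fun p => weyl x p.1 p.2 / (Real.sqrt (2 ^ n) : ℂ)

/-- Born rule: the probability of outcome `x` when two copies of `|ψ⟩` are measured in the Bell basis. -/
noncomputable def bellProb {n : ℕ} (ψ : Qubits n) (x : Phase n) : ℝ :=
  ‖inner ℂ (bellState x) (tensor ψ ψ)‖ ^ 2

/-- The outcomes of `m` Bell difference measurements: each of them makes two Bell measurements, on
`2 + 2` fresh copies of the state. -/
abbrev Outcomes (n m : ℕ) : Type := Fin m → Phase n × Phase n

/-- The `m` Bell difference samples: the sums in `𝔽₂^{2n}` of the two Bell outcomes. -/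
def samples {n m : ℕ} (ω : Outcomes n m) : Fin m → Phase n := fun i => (ω i).1 + (ω i).2

open scoped Classical in
/-- The probability of the event `E` when the `2 m` pairs among `4 m` copies of `|ψ⟩` are each measured
in the Bell basis. -/
noncomputable def outcomeProb {n m : ℕ} (ψ : Qubits n) (E : Outcomes n m → Prop) : ℝ :=
  ∑ ω : Outcomes n m, if E ω then ∏ i, bellProb ψ (ω i).1 * bellProb ψ (ω i).2 else 0

/-! ### The algorithm -/

/-- The number of Bell difference samples, `(2 log(1/δ) + 8n)/ε` rounded down to an integer. -/
noncomputable def sampleCount (n : ℕ) (ε δ : ℝ) : ℕ := ⌊(2 * Real.log (1 / δ) + 8 * n) / ε⌋₊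

/-- The value that the algorithm returns on given samples: `1` if `2n - dim H^⊥ ≥ k` and `0`
otherwise, where `H^⊥` is the span of the samples. -/
noncomputable def returnValue {n m : ℕ} (k : ℕ) (x : Fin m → Phase n) : ℕ :=
  if k ≤ 2 * n - Module.finrank (ZMod 2) (Submodule.span (ZMod 2) (Set.range x)) then 1 else 0

/-! ### The machine model

A program uses counters `0, 1, 2, …` holding natural numbers and a random access memory of bits, whose
cells are addressed by pairs of counters (row, column). Counters are changed in unit steps only, so
that their values never exceed the largest input by more than the running time. The only quantum
instruction takes two fresh copies of the state and measures them in the Bell basis. -/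

/-- Programs. The arguments are names of counters; `M[x, y]` is the memory cell in the row given
by the value of counter `x` and the column given by the value of counter `y`. -/
inductive Prog : Type
  /-- do nothing -/
  | skip : Prog
  /-- `x := 0` -/
  | clear (x : ℕ) : Prog
  /-- `x := x + 1` -/
  | inc (x : ℕ) : Prog
  /-- `x := x - 1`, or `0` if `x = 0` -/
  | dec (x : ℕ) : Prog
  /-- `x := y` -/
  | copy (x y : ℕ) : Prog
  /-- `M[x, y] := b` -/
  | setBit (x y : ℕ) (b : ZMod 2) : Prog
  /-- `M[x, y] := M[x, y] + M[u, v]` -/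
  | addBit (x y u v : ℕ) : Prog
  /-- Bell measurement of two fresh copies; the `2 n` outcome bits go to row `x`, columns `0, …, 2n-1` -/
  | bell (x : ℕ) : Prog
  /-- first `c`, then `d` -/
  | seq (c d : Prog) : Prog
  /-- if `x < y` then `c` else `d` -/
  | ifLt (x y : ℕ) (c d : Prog) : Prog
  /-- if `M[x, y] = 1` then `c` else `d` -/
  | ifBit (x y : ℕ) (c d : Prog) : Prog
  /-- while `x < y` do `c` -/
  | whileLt (x y : ℕ) (c : Prog) : Prog

/-- A configuration: counters, bit memory, the outcomes of the Bell measurements that can still be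
made, and the number of copies of the state used so far. Programs cannot read the last two. -/
structure Config (n : ℕ) where
  reg : ℕ → ℕ
  mem : ℕ → ℕ → ZMod 2
  pending : List (Phase n)
  copies : ℕ

/-- The `j`-th of the `2n` coordinates of `x = (a, b)`, counted from `0`. -/
def coord {n : ℕ} (x : Phase n) (j : ℕ) : ZMod 2 :=
  if h : j < n then x.1 ⟨j, h⟩ else if h : j - n < n then x.2 ⟨j - n, h⟩ else 0

namespace Config

variable {n : ℕ}

/-- Set counter `x` to `v`. -/
def setReg (s : Config n) (x v : ℕ) : Config n := { s with reg := Function.update s.reg x v }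

/-- The content of the cell `M[x, y]`. -/
def get (s : Config n) (x y : ℕ) : ZMod 2 := s.mem (s.reg x) (s.reg y)

/-- Write the bit `b` to the cell `M[x, y]`. -/
def put (s : Config n) (x y : ℕ) (b : ZMod 2) : Config n :=
  { s with mem := fun i j => if i = s.reg x ∧ j = s.reg y then b else s.mem i j }

/-- Two copies have been measured with outcome `v`, the outcomes `rest` remaining. -/
def measured (s : Config n) (x : ℕ) (v : Phase n) (rest : List (Phase n)) : Config n :=
  { s with
    mem := fun i j => if i = s.reg x ∧ j < 2 * n then coord v j else s.mem i j
    pending := rest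
    copies := s.copies + 2 }

end Config

/-- `Exec c s s' t`: the program `c`, started in configuration `s`, halts in configuration `s'` after
`t` steps. Simple instructions and tests take one step; a Bell measurement of two copies takes
`2n + 1` steps (two for each of its `n` two-qubit measurements, and one for the call). A program
that asks for a Bell measurement when no copies are left has no halting run. -/
inductive Exec {n : ℕ} : Prog → Config n → Config n → ℕ → Prop
  | skip (s : Config n) : Exec .skip s s 1
  | clear (s : Config n) (x : ℕ) : Exec (.clear x) s (s.setReg x 0) 1
  | inc (s : Config n) (x : ℕ) : Exec (.inc x) s (s.setReg x (s.reg x + 1)) 1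
  | dec (s : Config n) (x : ℕ) : Exec (.dec x) s (s.setReg x (s.reg x - 1)) 1
  | copy (s : Config n) (x y : ℕ) : Exec (.copy x y) s (s.setReg x (s.reg y)) 1
  | setBit (s : Config n) (x y : ℕ) (b : ZMod 2) : Exec (.setBit x y b) s (s.put x y b) 1
  | addBit (s : Config n) (x y u v : ℕ) :
      Exec (.addBit x y u v) s (s.put x y (s.get x y + s.get u v)) 1
  | bell (s : Config n) (x : ℕ) (v : Phase n) (rest : List (Phase n)) (h : s.pending = v :: rest) :
      Exec (.bell x) s (s.measured x v rest) (2 * n + 1)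
  | seq {c d : Prog} {s s' s'' : Config n} {t t' : ℕ} (h : Exec c s s' t) (h' : Exec d s' s'' t') :
      Exec (.seq c d) s s'' (t + t')
  | ifLt_true {x y : ℕ} {c d : Prog} {s s' : Config n} {t : ℕ} (hlt : s.reg x < s.reg y)
      (h : Exec c s s' t) : Exec (.ifLt x y c d) s s' (t + 1)
  | ifLt_false {x y : ℕ} {c d : Prog} {s s' : Config n} {t : ℕ} (hge : ¬ s.reg x < s.reg y)
      (h : Exec d s s' t) : Exec (.ifLt x y c d) s s' (t + 1)
  | ifBit_true {x y : ℕ} {c d : Prog} {s s' : Config n} {t : ℕ} (hb : s.get x y = 1)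
      (h : Exec c s s' t) : Exec (.ifBit x y c d) s s' (t + 1)
  | ifBit_false {x y : ℕ} {c d : Prog} {s s' : Config n} {t : ℕ} (hb : ¬ s.get x y = 1)
      (h : Exec d s s' t) : Exec (.ifBit x y c d) s s' (t + 1)
  | whileLt_done {x y : ℕ} {c : Prog} {s : Config n} (hge : ¬ s.reg x < s.reg y) :
      Exec (.whileLt x y c) s s 1
  | whileLt_step {x y : ℕ} {c : Prog} {s s' s'' : Config n} {t t' : ℕ} (hlt : s.reg x < s.reg y)
      (h : Exec c s s' t) (h' : Exec (.whileLt x y c) s' s'' t') :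
      Exec (.whileLt x y c) s s'' (t + t' + 1)

/-- A program has at most one halting run from each configuration. -/
theorem Exec.deterministic {n : ℕ} {c : Prog} {s s₁ : Config n} {t₁ : ℕ} (h₁ : Exec c s s₁ t₁) :
    ∀ {s₂ : Config n} {t₂ : ℕ}, Exec c s s₂ t₂ → s₁ = s₂ ∧ t₁ = t₂ := by
  induction h₁ with
  | bell s x v rest h => intro s₂ t₂ h₂; cases h₂; simp_all
  | seq h h' ih ih' =>
    intro s₂ t₂ h₂
    cases h₂ with
    | seq k k' =>
      obtain ⟨rfl, rfl⟩ := ih k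
      obtain ⟨rfl, rfl⟩ := ih' k'
      exact ⟨rfl, rfl⟩
  | whileLt_step hlt h h' ih ih' =>
    intro s₂ t₂ h₂
    cases h₂ with
    | whileLt_done hge => contradiction
    | whileLt_step _ k k' =>
      obtain ⟨rfl, rfl⟩ := ih k
      obtain ⟨rfl, rfl⟩ := ih' k'
      exact ⟨rfl, rfl⟩
  | whileLt_done hge => intro s₂ t₂ h₂; cases h₂ <;> simp_all
  | ifLt_true hc h ih =>
    intro s₂ t₂ h₂
    cases h₂ with
    | ifLt_true _ k => exact ⟨(ih k).1, congrArg (· + 1) (ih k).2⟩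
    | ifLt_false hc' k => contradiction
  | ifLt_false hc h ih =>
    intro s₂ t₂ h₂
    cases h₂ with
    | ifLt_true _ k => contradiction
    | ifLt_false hc' k => exact ⟨(ih k).1, congrArg (· + 1) (ih k).2⟩
  | ifBit_true hc h ih =>
    intro s₂ t₂ h₂
    cases h₂ with
    | ifBit_true _ k => exact ⟨(ih k).1, congrArg (· + 1) (ih k).2⟩
    | ifBit_false hc' k => contradiction
  | ifBit_false hc h ih =>
    intro s₂ t₂ h₂
    cases h₂ with
    | ifBit_true _ k => contradiction
    | ifBit_false hc' k => exact ⟨(ih k).1, congrArg (· + 1) (ih k).2⟩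
  | _ => intro s₂ t₂ h₂; cases h₂; exact ⟨rfl, rfl⟩

/-- The initial configuration: counters `0, 1, 2` hold `n`, `k` and the number `m` of Bell difference
samples, all other counters and all bits are `0`, and the `2m` Bell measurements have outcomes `ω`. -/
def initial {n m : ℕ} (k : ℕ) (ω : Outcomes n m) : Config n where
  reg := fun x => if x = 0 then n else if x = 1 then k else if x = 2 then m else 0
  mem := fun _ _ => 0
  pending := (List.ofFn fun i => [(ω i).1, (ω i).2]).flatten
  copies := 0

/-- The program `P` halts and returns `r` (in counter `0`) when the Bell outcomes are `ω`. -/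
def Returns {n m : ℕ} (P : Prog) (k : ℕ) (ω : Outcomes n m) (r : ℕ) : Prop :=
  ∃ (s : Config n) (t : ℕ), Exec P (initial k ω) s t ∧ s.reg 0 = r

end StabTest

open StabTest

/-! Write A(y) for `ambiguity ψ y`, which is ⟨ψ|W_y|ψ⟩ up to a phase. Under the symplectic Fourier
transform p_ψ becomes |A|² and the Bell outcome distribution becomes A². Convolution squares the
transform, and both squares equal |A|⁴ (A² being real here), so the sum of two Bell outcomes has law
q_ψ (`conv_bellProb`).

Completeness: if W_y stabilizes ψ up to sign, then |A(y)| = 1, so the sum of (-1)^[x,y] q_ψ(x) is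
already 1 and q_ψ lives on the complement of y. All samples therefore lie in the complement of the
stabilizer group, and their span has codimension at least the stabilizer dimension.

Soundness: by Fourier duality the q_ψ-mass of a subspace S is the average of |A|⁴ over T = S^⊥
(`sum_bellDiffDist_perp`). If it exceeds 5/8, the uncertainty relation for anticommuting Weyl
operators makes T isotropic (`isotropic_of_sum_ambiguity`). The operators W_y, y ∈ T, then have
joint eigenspaces, and the average of |A|² over T is the sum of the squares of the weights of ψ in
them. This is at most the largest weight, which is the fidelity of ψ with a state stabilized up to
signs by T (`exists_fidelity_ge`). Hence a wrong answer 1 forces the span of the samples to have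
mass at most 1 - ε. As long as the mass is that small, each new sample enlarges the span with
probability at least ε; following the expectation of 2^(-dim) bounds the failure probability by 4^n
(1 - ε/2)^m ≤ δ (`sum_span_mass_le`).

The program keeps an echelon basis in rows 0, …, 2n-1, row i being zero or having its leading one in
column i. Reducing one sample costs O(n²) steps, and the number of zero rows is the codimension of
the span. -/

namespace StabTest

/-! ### Running programs -/

/-- A counting loop preserving an invariant, with a bound on the cost of its body. -/
theorem Exec.forLoop {n : ℕ} {x y : ℕ} {c : Prog} (N B : ℕ) (Inv : ℕ → Config n → Prop)
    (hreg : ∀ j s, Inv j s → s.reg x = j ∧ s.reg y = N)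
    (hbody : ∀ j s, j < N → Inv j s → ∃ s' t, Exec c s s' t ∧ Inv (j + 1) s' ∧ t ≤ B)
    {s : Config n} (h0 : Inv 0 s) :
    ∃ s' t, Exec (.whileLt x y c) s s' t ∧ Inv N s' ∧ t ≤ N * (B + 1) + 1 := by
  have key : ∀ d j : ℕ, j + d = N → ∀ s, Inv j s →
      ∃ s' t, Exec (.whileLt x y c) s s' t ∧ Inv N s' ∧ t ≤ d * (B + 1) + 1 := by
    intro d
    induction d with
    | zero =>
      intro j hj s hs
      obtain ⟨h1, h2⟩ := hreg j s hs
      obtain rfl : j = N := by omega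
      exact ⟨s, 1, .whileLt_done (by omega), hs, by omega⟩
    | succ d ih =>
      intro j hj s hs
      obtain ⟨h1, h2⟩ := hreg j s hs
      obtain ⟨s', t, e, hs', ht⟩ := hbody j s (by omega) hs
      obtain ⟨s'', t', e', hs'', ht'⟩ := ih (j + 1) (by omega) s' hs'
      exact ⟨s'', t + t' + 1, .whileLt_step (by omega) e e', hs'', by linarith⟩
  exact key N 0 (by omega) s h0

/-- Add the row addressed by counter `u` to the row addressed by counter `x`, in the columns below
the value of counter `3`. Uses counter `8`. -/
def addRow (x u : ℕ) : Prog :=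
  .seq (.clear 8) (.whileLt 8 3 (.seq (.addBit x 8 u 8) (.inc 8)))

/-- Round j touches only column j, so the summand is read before it can change, even if both
counters address the same row. -/
theorem exec_addRow {n : ℕ} (s : Config n) {x u : ℕ} (hx : x ≠ 8) (hu : u ≠ 8) :
    ∃ s' t, Exec (addRow x u) s s' t ∧ (∀ r, r ≠ 8 → s'.reg r = s.reg r) ∧
      s'.pending = s.pending ∧ s'.copies = s.copies ∧
      (∀ i l, s'.mem i l = if i = s.reg x ∧ l < s.reg 3 then s.mem i l + s.mem (s.reg u) l
        else s.mem i l) ∧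
      t ≤ 3 * s.reg 3 + 2 := by
  obtain ⟨s', t, e, ⟨-, h1, h2, h3, h4⟩, ht⟩ := Exec.forLoop (x := 8) (y := 3)
    (c := .seq (.addBit x 8 u 8) (.inc 8)) (s.reg 3) 2
    (fun j (s' : Config n) => s'.reg 8 = j ∧ (∀ r, r ≠ 8 → s'.reg r = s.reg r) ∧
      s'.pending = s.pending ∧ s'.copies = s.copies ∧
      (∀ i l, s'.mem i l = if i = s.reg x ∧ l < j then s.mem i l + s.mem (s.reg u) l
        else s.mem i l))
    (fun j s' h => ⟨h.1, h.2.1 3 (by decide)⟩)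
    (by
      rintro j s' hj ⟨h0, h1, h2, h3, h4⟩
      refine ⟨_, _, .seq (.addBit ..) (.inc ..), ⟨?_, ?_, ?_, ?_, ?_⟩, le_rfl⟩
      · simp [Config.setReg, Config.put, h0]
      · intro r hr
        simp [Config.setReg, Config.put, hr, h1]
      · simpa [Config.setReg, Config.put] using h2
      · simpa [Config.setReg, Config.put] using h3
      · intro i l
        simp only [Config.setReg, Config.put, Config.get, h0, h1 x hx, h1 u hu, h4]
        by_cases hi : i = s.reg x
        · subst hi
          rcases lt_trichotomy l j with hl | rfl | hl
          · simp [hl, hl.ne, hl.trans (Nat.lt_succ_self j)]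
          · simp
          · simp [hl.ne', hl.not_gt, show ¬ l < j + 1 by omega]
        · simp [hi])
    (s := s.setReg 8 0)
    (by
      refine ⟨by simp [Config.setReg], fun r hr => by simp [Config.setReg, hr], rfl, rfl, ?_⟩
      intro i l; simp [Config.setReg])
  exact ⟨s', 1 + t, .seq (.clear ..) e, h1, h2, h3, h4, by omega⟩

/-! ### Incremental Gaussian elimination -/

/-- The first `d` entries of row `i`. -/
def row (M : ℕ → ℕ → ZMod 2) (d i : ℕ) : Fin d → ZMod 2 := fun l => M i l

/-- The span of the first `d` rows. -/
def rowSpan (M : ℕ → ℕ → ZMod 2) (d : ℕ) : Submodule (ZMod 2) (Fin d → ZMod 2) :=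
  Submodule.span (ZMod 2) (Set.range fun i : Fin d => row M d i)

/-- The rows `i < d` are each either zero or have their leading one in column `i`. -/
def Echelon (M : ℕ → ℕ → ZMod 2) (d : ℕ) : Prop :=
  ∀ i < d, (∀ l < i, M i l = 0) ∧ (M i i = 1 ∨ ∀ l < d, M i l = 0)

/-- The rows `i < d` with a leading one. -/
def pivots (M : ℕ → ℕ → ZMod 2) (d : ℕ) : Finset (Fin d) :=
  Finset.univ.filter fun i => M i i = 1

theorem Echelon.finrank_rowSpan {M : ℕ → ℕ → ZMod 2} {d : ℕ} (h : Echelon M d) :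
    Module.finrank (ZMod 2) (rowSpan M d) = (pivots M d).card := by
  classical
  -- Filling the missing pivots with unit vectors gives a unitriangular matrix, so the pivot rows
  -- are independent; the other rows vanish.
  let U : Matrix (Fin d) (Fin d) (ZMod 2) :=
    Matrix.of fun i => if M i i = 1 then row M d i else Pi.single i 1
  have hU : U.det = 1 := by
    rw [Matrix.det_of_isUpperTriangular]
    · refine Finset.prod_eq_one fun i _ => ?_
      by_cases hi : M i i = 1 <;> simp [U, hi, row]
    · intro i j hij
      have hij' : j < i := hij
      by_cases hi : M i i = 1
      · simpa [U, hi, row] using (h i i.2).1 j hij'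
      · simp [U, hi, hij'.ne]
  have hLI : LinearIndependent (ZMod 2) U.row :=
    Matrix.linearIndependent_rows_iff_isUnit.2 ((Matrix.isUnit_iff_isUnit_det U).2 (by simp [hU]))
  have hLI' : LinearIndependent (ZMod 2) fun i : pivots M d => row M d i.1 := by
    have := hLI.comp (fun i : pivots M d => i.1) Subtype.val_injective
    convert this using 1
    funext i
    have hi : M i.1 i.1 = 1 := by simpa [pivots] using i.2
    exact (if_pos hi).symm
  have hspan : rowSpan M d = Submodule.span (ZMod 2)
      (Set.range fun i : pivots M d => row M d i.1) := by
    refine le_antisymm (Submodule.span_le.2 ?_) (Submodule.span_mono ?_)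
    · rintro _ ⟨i, rfl⟩
      rcases (h i i.2).2 with hi | hi
      · exact Submodule.subset_span ⟨⟨i, by simp [pivots, hi]⟩, rfl⟩
      · have : row M d i = 0 := by funext l; exact hi l l.2
        simp [this]
    · rintro _ ⟨i, rfl⟩
      exact ⟨i.1, rfl⟩
  rw [hspan, finrank_span_eq_card hLI', Fintype.card_coe]

/-- The state of the elimination of row `d` against the rows `i < d`, columns `l < j` being done;
`D` is the number of rows without a leading one. -/
structure Reducing (M : ℕ → ℕ → ZMod 2) (d j D : ℕ)
    (W : Submodule (ZMod 2) (Fin d → ZMod 2)) : Prop where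
  echelon : Echelon M d
  zero : ∀ l < j, M d l = 0
  span : rowSpan M d ⊔ Submodule.span (ZMod 2) {row M d d} = W
  count : D + (pivots M d).card = d

variable {M M' : ℕ → ℕ → ZMod 2} {d j D : ℕ} {W : Submodule (ZMod 2) (Fin d → ZMod 2)}

theorem Reducing.skip (h : Reducing M d j D W) (h0 : M d j ≠ 1) : Reducing M d (j + 1) D W where
  echelon := h.echelon
  zero l hl := by
    rcases Nat.lt_succ_iff_lt_or_eq.1 hl with hl | rfl
    · exact h.zero l hl
    · generalize M d l = b at *
      revert b; decide
  span := h.span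
  count := h.count

/-- Row j belongs to the basis, so adding it to row d preserves the joint span; it vanishes left of
column j, so the zeros already produced survive. -/
theorem Reducing.cancel (h : Reducing M d j D W) (hj : j < d) (h1 : M d j = 1) (hp : M j j = 1)
    (hM : ∀ i l, M' i l = if i = d ∧ l < d then M i l + M j l else M i l) :
    Reducing M' d (j + 1) D W := by
  have hrow : ∀ i < d, ∀ l, M' i l = M i l := fun i hi l => by simp [hM, hi.ne]
  have hrs : rowSpan M' d = rowSpan M d := by
    unfold rowSpan
    congr 2
    funext i l
    exact hrow i i.2 l
  have hd : row M' d d = row M d d + row M d j := by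
    funext l
    simp [row, hM]
  have hmem : row M d j ∈ rowSpan M d := Submodule.subset_span ⟨⟨j, hj⟩, rfl⟩
  refine ⟨?_, ?_, ?_, ?_⟩
  · intro i hi
    simpa only [hrow i hi] using h.echelon i hi
  · intro l hl
    rw [hM, if_pos ⟨rfl, by omega⟩]
    rcases Nat.lt_succ_iff_lt_or_eq.1 hl with hl | rfl
    · rw [h.zero l hl, (h.echelon j hj).1 l hl, add_zero]
    · rw [h1, hp]; decide
  · rw [hrs, hd, ← h.span]
    refine le_antisymm (sup_le le_sup_left ?_) (sup_le le_sup_left ?_)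
    · rw [Submodule.span_singleton_le_iff_mem]
      exact add_mem (Submodule.mem_sup_right (Submodule.mem_span_singleton_self _))
        (Submodule.mem_sup_left hmem)
    · rw [Submodule.span_singleton_le_iff_mem]
      rw [← Submodule.add_mem_iff_left _ (Submodule.mem_sup_left hmem)]
      exact Submodule.mem_sup_right (Submodule.mem_span_singleton_self _)
  · have : pivots M' d = pivots M d := by
      unfold pivots
      congr 1
      funext i
      rw [hrow i i.2]
    rw [this, h.count]

/-- Without a leading one, row j is zero and can take over row d. Row d is then zero in every
column, so the remaining columns need no work. -/
theorem Reducing.insert (h : Reducing M d j D W) (hj : j < d) (h1 : M d j = 1) (hp : M j j ≠ 1)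
    (hM : ∀ i l, M' i l = if i = j ∧ l < d then M d l else if i = d ∧ l < d then 0 else M i l) :
    Reducing M' d (j + 1) (D - 1) W := by
  have hz : ∀ l < d, M j l = 0 := ((h.echelon j hj).2).resolve_left hp
  have hrow : ∀ i < d, i ≠ j → ∀ l, M' i l = M i l := fun i hi hij l => by simp [hM, hi.ne, hij]
  have hrowj : row M' d j = row M d d := by
    funext l
    simp [row, hM]
  have hd : row M' d d = 0 := by
    funext l
    simp [row, hM, hj.ne']
  have hpiv : pivots M' d = Insert.insert ⟨j, hj⟩ (pivots M d) := by
    ext i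
    by_cases hij : i.1 = j
    · have : i = ⟨j, hj⟩ := Fin.ext hij
      subst this
      simp [pivots, hM, h1]
    · have : i ≠ ⟨j, hj⟩ := fun e => hij (by rw [e])
      simp [pivots, hrow i i.2 hij, this]
  have hnot : (⟨j, hj⟩ : Fin d) ∉ pivots M d := by simp [pivots, hp]
  have hcard : (pivots M' d).card = (pivots M d).card + 1 := by
    rw [hpiv, Finset.card_insert_of_notMem hnot]
  -- The new pivot fits, so D was positive and the truncated subtraction D - 1 is exact.
  have hle : (pivots M' d).card ≤ d := by
    simpa using Finset.card_le_univ (pivots M' d)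
  have hc := h.count
  refine ⟨?_, ?_, ?_, by omega⟩
  · intro i hi
    by_cases hij : i = j
    · subst hij
      refine ⟨fun l hl => ?_, Or.inl ?_⟩
      · rw [hM, if_pos ⟨rfl, hl.trans hj⟩, h.zero l hl]
      · rw [hM, if_pos ⟨rfl, hj⟩, h1]
    · simpa only [hrow i hi hij] using h.echelon i hi
  · intro l hl
    rw [hM, if_neg (by omega), if_pos ⟨rfl, by omega⟩]
  · rw [hd, ← h.span]
    simp only [Submodule.span_zero_singleton, sup_bot_eq]
    refine le_antisymm (Submodule.span_le.2 ?_) (sup_le (Submodule.span_le.2 ?_) ?_)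
    · rintro _ ⟨i, rfl⟩
      by_cases hij : i.1 = j
      · simp only [hij, hrowj]
        exact Submodule.mem_sup_right (Submodule.mem_span_singleton_self _)
      · have : row M' d i = row M d i := by funext l; exact hrow i i.2 hij l
        simp only [this]
        exact Submodule.mem_sup_left (Submodule.subset_span ⟨i, rfl⟩)
    · rintro _ ⟨i, rfl⟩
      by_cases hij : i.1 = j
      · have : row M d i = 0 := by funext l; rw [row, hij]; exact hz l l.2
        simp [this]
      · have : row M d i = row M' d i := by funext l; exact (hrow i i.2 hij l).symm
        simp only [this]
        exact Submodule.subset_span ⟨i, rfl⟩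
    · rw [Submodule.span_singleton_le_iff_mem, ← hrowj]
      exact Submodule.subset_span ⟨⟨j, hj⟩, rfl⟩

end StabTest

namespace StabTest

/-! ### The program -/

/-- Reduce row `2n` against the rows above it, inserting it into the basis if it is new.
Counter `3` holds `2n`, counter `7` runs over the columns, and counter `4` holds the number of rows
without a leading one. -/
def reduceRow : Prog :=
  .seq (.clear 7) (.whileLt 7 3 (.seq
    (.ifBit 3 7 (.seq (.ifBit 7 7 .skip (.seq (.dec 4) (addRow 7 3))) (addRow 3 7)) .skip)
    (.inc 7)))

theorem exec_reduceRow {n d : ℕ} (s : Config n) (hd : s.reg 3 = d)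
    {W : Submodule (ZMod 2) (Fin d → ZMod 2)} (h : Reducing s.mem d 0 (s.reg 4) W) :
    ∃ s' t, Exec reduceRow s s' t ∧ (∀ r, r ≠ 4 → r ≠ 7 → r ≠ 8 → s'.reg r = s.reg r) ∧
      s'.pending = s.pending ∧ s'.copies = s.copies ∧
      Reducing s'.mem d d (s'.reg 4) W ∧ t ≤ d * (6 * d + 9) + 2 := by
  obtain ⟨s', t, e, ⟨-, h1, h2, h3, h4⟩, ht⟩ := Exec.forLoop (x := 7) (y := 3)
    (c := .seq
      (.ifBit 3 7 (.seq (.ifBit 7 7 .skip (.seq (.dec 4) (addRow 7 3))) (addRow 3 7)) .skip)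
      -- The costliest round has two row additions (3d + 2 each), two tests, one decrement and one
      -- increment.
      (.inc 7)) d (6 * d + 8)
    (fun j (s' : Config n) => s'.reg 7 = j ∧
      (∀ r, r ≠ 4 → r ≠ 7 → r ≠ 8 → s'.reg r = s.reg r) ∧
      s'.pending = s.pending ∧ s'.copies = s.copies ∧ Reducing s'.mem d j (s'.reg 4) W)
    (fun j s' h => ⟨h.1, by rw [h.2.1 3 (by decide) (by decide) (by decide), hd]⟩)
    (by
      rintro j s' hj ⟨h0, h1, h2, h3, h4⟩
      have hd' : s'.reg 3 = d := by rw [h1 3 (by decide) (by decide) (by decide), hd]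
      by_cases hb : s'.get 3 7 = 1
      · have hb' : s'.mem d j = 1 := by simpa [Config.get, hd', h0] using hb
        by_cases hp : s'.get 7 7 = 1
        · have hp' : s'.mem j j = 1 := by simpa [Config.get, h0] using hp
          obtain ⟨u, t, e, g1, g2, g3, g4, ht⟩ :=
            exec_addRow s' (x := 3) (u := 7) (by decide) (by decide)
          refine ⟨_, _, .seq (.ifBit_true hb (.seq (.ifBit_true hp (.skip _)) e)) (.inc ..),
            ⟨?_, ?_, ?_, ?_, ?_⟩, ?_⟩
          · simp [Config.setReg, g1, h0]
          · intro r r4 r7 r8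
            simp [Config.setReg, r7, g1 r r8, h1 r r4 r7 r8]
          · simp [Config.setReg, g2, h2]
          · simp [Config.setReg, g3, h3]
          · have := h4.cancel (M' := u.mem) hj hb' hp' (by simpa [hd', h0] using g4)
            simpa [Config.setReg, g1] using this
          · rw [hd'] at ht
            omega
        · have hp' : s'.mem j j ≠ 1 := by simpa [Config.get, h0] using hp
          have hz : ∀ l < d, s'.mem j l = 0 := ((h4.echelon j hj).2).resolve_left hp'
          -- Adding row d to the zero row j copies it; adding row j back to row d clears row d in
          -- characteristic 2.
          obtain ⟨u, t, e, g1, g2, g3, g4, ht⟩ :=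
            exec_addRow (s'.setReg 4 (s'.reg 4 - 1)) (x := 7) (u := 3) (by decide) (by decide)
          obtain ⟨u', t', e', g1', g2', g3', g4', ht'⟩ :=
            exec_addRow u (x := 3) (u := 7) (by decide) (by decide)
          have hu3 : u.reg 3 = d := by rw [g1 3 (by decide)]; simpa [Config.setReg] using hd'
          have hu7 : u.reg 7 = j := by rw [g1 7 (by decide)]; simpa [Config.setReg] using h0
          refine ⟨_, _, .seq (.ifBit_true hb (.seq (.ifBit_false hp (.seq (.dec ..) e)) e'))
            (.inc ..), ⟨?_, ?_, ?_, ?_, ?_⟩, ?_⟩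
          · simp [Config.setReg, g1', hu7]
          · intro r r4 r7 r8
            simp [Config.setReg, r7, r4, g1' r r8, g1 r r8, h1 r r4 r7 r8]
          · simp [Config.setReg, g2', g2, h2]
          · simp [Config.setReg, g3', g3, h3]
          · have := h4.insert (M' := u'.mem) hj hb' hp' (by
              intro i l
              rw [g4', g4, g4, hu3, hu7]
              simp only [Config.setReg, h0, hd', Function.update_of_ne, ne_eq, Nat.reduceEqDiff,
                not_false_eq_true]
              by_cases hl : l < d
              · by_cases hi : i = j
                · subst hi
                  simp [hl, hj.ne, hz l hl]
                · by_cases hi' : i = d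
                  · subst hi'
                    simp [hl, hj.ne', hz l hl, CharTwo.add_self_eq_zero]
                  · simp [hi, hi']
              · simp [hl])
            simpa [Config.setReg, g1', g1] using this
          · have h3 : (s'.setReg 4 (s'.reg 4 - 1)).reg 3 = d := by simpa [Config.setReg] using hd'
            rw [h3] at ht
            rw [hu3] at ht'
            omega
      · have hb' : s'.mem d j ≠ 1 := by simpa [Config.get, hd', h0] using hb
        refine ⟨_, _, .seq (.ifBit_false hb (.skip _)) (.inc ..), ⟨?_, ?_, h2, h3, ?_⟩, by omega⟩
        · simp [Config.setReg, h0]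
        · intro r r4 r7 r8
          simp [Config.setReg, r7, h1 r r4 r7 r8]
        · simpa [Config.setReg] using h4.skip hb')
    (s := s.setReg 7 0)
    (by
      refine ⟨by simp [Config.setReg], fun r _ hr _ => by simp [Config.setReg, hr], rfl, rfl, ?_⟩
      simpa [Config.setReg] using h)
  exact ⟨s', 1 + t, .seq (.clear ..) e, h1, h2, h3, h4, by linarith⟩

/-- The vector of the `2n` coordinates of `x`. -/
def coordMap (n : ℕ) : Phase n →ₗ[ZMod 2] (Fin (2 * n) → ZMod 2) where
  toFun x j := coord x j
  map_add' x y := by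
    funext j
    simp only [coord, Pi.add_apply, Prod.fst_add, Prod.snd_add]
    split_ifs <;> simp
  map_smul' c x := by
    funext j
    simp only [coord, Pi.smul_apply, Prod.smul_fst, Prod.smul_snd, RingHom.id_apply]
    split_ifs <;> simp

theorem coordMap_injective (n : ℕ) : Function.Injective (coordMap n) := by
  intro x y h
  refine Prod.ext (funext fun i => ?_) (funext fun i => ?_)
  · have := congrFun h ⟨i, by omega⟩
    simpa [coordMap, coord] using this
  · have := congrFun h ⟨n + i, by omega⟩
    simpa [coordMap, coord] using this

/-- Draw one Bell difference sample into row `2n`; row `2n + 1` holds the second outcome. -/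
def drawSample : Prog := .seq (.bell 3) (.seq (.bell 6) (addRow 3 6))

/-- Two measurements cost 4n + 2 steps and the row addition 6n + 2. The scratch rows 2n and 2n + 1
lie below the basis, which stays intact. -/
theorem exec_drawSample {n : ℕ} (s : Config n) (h3 : s.reg 3 = 2 * n) (h6 : s.reg 6 = 2 * n + 1)
    {v w : Phase n} {rest : List (Phase n)} (hs : s.pending = v :: w :: rest) :
    ∃ s' t, Exec drawSample s s' t ∧ (∀ r, r ≠ 8 → s'.reg r = s.reg r) ∧
      s'.pending = rest ∧ s'.copies = s.copies + 4 ∧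
      (∀ i < 2 * n, ∀ l, s'.mem i l = s.mem i l) ∧
      row s'.mem (2 * n) (2 * n) = coordMap n (v + w) ∧
      t ≤ 10 * n + 4 := by
  have e1 := Exec.bell s 3 v (w :: rest) hs
  have e2 := Exec.bell (s.measured 3 v (w :: rest)) 6 w rest rfl
  obtain ⟨s', t, e, g1, g2, g3, g4, ht⟩ :=
    exec_addRow ((s.measured 3 v (w :: rest)).measured 6 w rest) (x := 3) (u := 6)
      (by decide) (by decide)
  refine ⟨_, _, .seq e1 (.seq e2 e), ?_, ?_, ?_, ?_, ?_, ?_⟩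
  · intro r hr
    simp [g1 r hr, Config.measured]
  · simp [g2, Config.measured]
  · simp [g3, Config.measured]
  · intro i hi l
    simp [g4, Config.measured, h3, h6, hi.ne, (hi.trans (Nat.lt_succ_self _)).ne]
  · rw [map_add]
    funext l
    simp [g4, Config.measured, h3, h6, row, coordMap]
  · simp only [Config.measured, h3] at ht
    omega

/-- Set counters `3`, `4`, `6` to `2n`, `2n` and `2n + 1`. -/
def setup : Prog :=
  .seq (.whileLt 7 0 (.seq (.inc 3) (.seq (.inc 3) (.inc 7))))
    (.seq (.copy 4 3) (.seq (.copy 6 3) (.inc 6)))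

theorem exec_setup {n m : ℕ} (k : ℕ) (ω : Outcomes n m) :
    ∃ s t, Exec setup (initial k ω) s t ∧ s.reg 1 = k ∧ s.reg 2 = m ∧ s.reg 3 = 2 * n ∧
      s.reg 4 = 2 * n ∧ s.reg 6 = 2 * n + 1 ∧ s.reg 9 = 0 ∧
      s.pending = (initial k ω).pending ∧ s.copies = 0 ∧ s.mem = (fun _ _ => 0) ∧
      t ≤ 4 * n + 4 := by
  obtain ⟨s, t, e, ⟨-, h3, h1, h2, h9, hp⟩, ht⟩ := Exec.forLoop (x := 7) (y := 0)
    (c := .seq (.inc 3) (.seq (.inc 3) (.inc 7))) n 3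
    (fun j (s : Config n) => (s.reg 7 = j ∧ s.reg 0 = n) ∧ s.reg 3 = 2 * j ∧ s.reg 1 = k ∧
      s.reg 2 = m ∧ s.reg 9 = 0 ∧ s.pending = (initial k ω).pending ∧ s.copies = 0 ∧
      s.mem = (fun _ _ => 0))
    (fun j s h => h.1)
    (by
      rintro j s hj ⟨⟨h7, h0⟩, h3, h1, h2, h9, hp, hc, hm⟩
      refine ⟨_, _, .seq (.inc ..) (.seq (.inc ..) (.inc ..)), ?_, le_rfl⟩
      simp [Config.setReg, h7, h0, h3, h1, h2, h9, hp, hc, hm]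
      omega)
    (s := initial k ω) (by simp [initial])
  refine ⟨_, _, .seq e (.seq (.copy ..) (.seq (.copy ..) (.inc ..))), ?_⟩
  simp [Config.setReg, h3, h1, h2, h9, hp]
  omega

/-- The program: draw the samples, keep a basis of their span in echelon form, and compare the
codimension of the span with `k`. -/
def stabDimTester : Prog :=
  .seq setup (.seq
    (.whileLt 9 2 (.seq drawSample (.seq reduceRow (.inc 9))))
    (.ifLt 4 1 (.clear 0) (.seq (.clear 0) (.inc 0))))

theorem exec_stabDimTester {n m : ℕ} (k : ℕ) (ω : Outcomes n m) :
    ∃ s t, Exec stabDimTester (initial k ω) s t ∧ s.reg 0 = returnValue k (samples ω) ∧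
      s.copies = 4 * m ∧ t ≤ m * (24 * n ^ 2 + 28 * n + 8) + 4 * n + 9 := by
  obtain ⟨s, t, e, h1, h2, h3, h4, h6, h9, hp, hc, hm, ht⟩ := exec_setup k ω
  have hspan : ∀ p (hp : p < m),
      Submodule.span (ZMod 2) ((coordMap n ∘ samples ω) '' {i | i.1 < p + 1}) =
      Submodule.span (ZMod 2) ((coordMap n ∘ samples ω) '' {i | i.1 < p}) ⊔
        Submodule.span (ZMod 2) {coordMap n (samples ω ⟨p, hp⟩)} := by
    intro p hp
    rw [← Submodule.span_union]
    congr 1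
    have : {i : Fin m | i.1 < p + 1} = {i | i.1 < p} ∪ {⟨p, hp⟩} := by
      ext i
      simp [Fin.ext_iff]
      omega
    rw [this, Set.image_union, Set.image_singleton]
    rfl
  obtain ⟨s', t', e', ⟨-, -, g1, g3, g6, gp, gc, ge, gs, gn⟩, ht'⟩ := Exec.forLoop (x := 9) (y := 2)
    -- Per sample: 10n + 4 for drawing, 2n(12n + 9) + 2 for reducing, 1 for the increment.
    (c := .seq drawSample (.seq reduceRow (.inc 9))) m (24 * n ^ 2 + 28 * n + 7)
    (fun p (s : Config n) => s.reg 9 = p ∧ s.reg 2 = m ∧ s.reg 1 = k ∧ s.reg 3 = 2 * n ∧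
      s.reg 6 = 2 * n + 1 ∧
      s.pending = ((List.ofFn fun i => [(ω i).1, (ω i).2]).drop p).flatten ∧
      s.copies = 4 * p ∧ Echelon s.mem (2 * n) ∧
      rowSpan s.mem (2 * n) =
        Submodule.span (ZMod 2) ((coordMap n ∘ samples ω) '' {i | i.1 < p}) ∧
      s.reg 4 + (pivots s.mem (2 * n)).card = 2 * n)
    (fun p s h => ⟨h.1, h.2.1⟩)
    (by
      rintro p s hp ⟨h9, h2, h1, h3, h6, hpend, hc, he, hs, hn⟩
      have hpend' : s.pending = (ω ⟨p, hp⟩).1 :: (ω ⟨p, hp⟩).2 ::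
          ((List.ofFn fun i => [(ω i).1, (ω i).2]).drop (p + 1)).flatten := by
        rw [hpend, List.drop_eq_getElem_cons (by simpa using hp)]
        simp
      obtain ⟨u, t, e, a1, a2, a3, a4, a5, ht⟩ := exec_drawSample s h3 h6 hpend'
      have hu3 : u.reg 3 = 2 * n := by rw [a1 3 (by decide), h3]
      have hR : Reducing u.mem (2 * n) 0 (u.reg 4)
          (Submodule.span (ZMod 2) ((coordMap n ∘ samples ω) '' {i | i.1 < p + 1})) := by
        refine ⟨?_, by simp, ?_, ?_⟩
        · intro i hi
          simpa only [a4 i hi] using he i hi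
        · rw [hspan p hp, a5, ← hs]
          congr 1
          unfold rowSpan
          congr 2
          funext i l
          exact a4 i i.2 l
        · have : pivots u.mem (2 * n) = pivots s.mem (2 * n) := by
            unfold pivots
            congr 1
            funext i
            rw [a4 i i.2]
          rw [this, a1 4 (by decide), hn]
      obtain ⟨u', t', e', b1, b2, b3, b4, ht'⟩ := exec_reduceRow u hu3 hR
      -- The scratch row ends up zero, so the basis rows alone span the samples drawn so far.
      have hz : row u'.mem (2 * n) (2 * n) = 0 := funext fun l => b4.zero l l.2
      refine ⟨_, _, .seq e (.seq e' (.inc ..)), ⟨?_, ?_, ?_, ?_, ?_, ?_, ?_, ?_, ?_, ?_⟩, ?_⟩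
      · simp [Config.setReg, b1, a1, h9]
      · simp [Config.setReg, b1, a1, h2]
      · simp [Config.setReg, b1, a1, h1]
      · simp [Config.setReg, b1, a1, h3]
      · simp [Config.setReg, b1, a1, h6]
      · simp [Config.setReg, b2, a2]
      · simp [Config.setReg, b3, a3, hc, mul_add]
      · exact b4.echelon
      · have := b4.span
        rwa [hz, Submodule.span_zero_singleton, sup_bot_eq] at this
      · exact b4.count
      · nlinarith)
    (s := s)
    (by
      refine ⟨h9, h2, h1, h3, h6, by simp [hp, initial], hc, ?_, ?_, ?_⟩
      · intro i hi
        simp [hm]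
      · simp only [hm, rowSpan]
        simp
        intro i
        rfl
      · simp [hm, h4, pivots])
  have hrank : s'.reg 4 =
      2 * n - Module.finrank (ZMod 2) (Submodule.span (ZMod 2) (Set.range (samples ω))) := by
    have hset : (coordMap n ∘ samples ω) '' {i | i.1 < m} =
        coordMap n '' Set.range (samples ω) := by
      have : {i : Fin m | i.1 < m} = Set.univ := Set.eq_univ_of_forall fun i => i.2
      rw [this, Set.image_univ, Set.range_comp]
    have h := ge.finrank_rowSpan
    rw [gs, hset, Submodule.span_image, 
      ← (Submodule.equivMapOfInjective _ (coordMap_injective n) _).finrank_eq] at h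
    omega
  by_cases hk : s'.reg 4 < s'.reg 1
  · refine ⟨_, _, .seq e (.seq e' (.ifLt_true hk (.clear ..))), ?_, ?_, ?_⟩
    · rw [g1, hrank] at hk
      simp [Config.setReg, returnValue, hk]
    · simp [Config.setReg, gc]
    · nlinarith
  · refine ⟨_, _, .seq e (.seq e' (.ifLt_false hk (.seq (.clear ..) (.inc ..)))), ?_, ?_, ?_⟩
    · rw [g1, hrank, not_lt] at hk
      simp [Config.setReg, returnValue, hk]
    · simp [Config.setReg, gc]
    · nlinarith

end StabTest

namespace StabTest

/-! ### Signs and character sums -/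

/-- The sign `(-1)^c`. -/
def sgn (c : ZMod 2) : ℝ := (-1) ^ c.val

@[simp] theorem sgn_zero : sgn 0 = 1 := by simp [sgn]

@[simp] theorem sgn_one : sgn 1 = -1 := by simp [sgn, ZMod.val_one]

theorem zmod_two_cases (c : ZMod 2) : c = 0 ∨ c = 1 := by
  revert c; decide

theorem sgn_add (c d : ZMod 2) : sgn (c + d) = sgn c * sgn d := by
  rcases zmod_two_cases c with rfl | rfl <;> rcases zmod_two_cases d with rfl | rfl <;>
    simp [CharTwo.add_self_eq_zero]

theorem sgn_mul_self (c : ZMod 2) : sgn c * sgn c = 1 := by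
  rcases zmod_two_cases c with rfl | rfl <;> simp

theorem sgn_eq_one_iff {c : ZMod 2} : sgn c = 1 ↔ c = 0 := by
  rcases zmod_two_cases c with rfl | rfl <;> norm_num

theorem sgn_eq (c : ZMod 2) : sgn c = 1 ∨ sgn c = -1 := by
  rcases zmod_two_cases c with rfl | rfl <;> simp

theorem sgn_sum {ι : Type*} (s : Finset ι) (f : ι → ZMod 2) :
    sgn (∑ i ∈ s, f i) = ∏ i ∈ s, sgn (f i) := by
  classical
  induction s using Finset.induction_on with
  | empty => simp
  | insert a s ha ih => rw [Finset.sum_insert ha, Finset.prod_insert ha, sgn_add, ih]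

/-- Translation by w permutes the group and flips the sign of every term. -/
theorem sum_sgn_eq_zero {W : Type*} [AddCommGroup W] [Fintype W] (f : W →+ ZMod 2) {w : W}
    (hw : f w ≠ 0) : ∑ x, sgn (f x) = 0 := by
  have hw' : f w = 1 := (zmod_two_cases _).resolve_left hw
  have h : ∑ x, sgn (f x) = ∑ x, sgn (f (x + w)) :=
    (Equiv.sum_comp (Equiv.addRight w) fun x => sgn (f x)).symm
  simp only [map_add, sgn_add, hw', sgn_one, mul_neg, mul_one, Finset.sum_neg_distrib] at h
  linarith

theorem sum_sgn_dotProduct {n : ℕ} (u : Fin n → ZMod 2) :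
    ∑ b : Fin n → ZMod 2, sgn (b ⬝ᵥ u) = if u = 0 then 2 ^ n else 0 := by
  split_ifs with h
  · simp [h]
  · obtain ⟨i, hi⟩ := Function.ne_iff.1 h
    exact sum_sgn_eq_zero
      (AddMonoidHom.mk' (fun b : Fin n → ZMod 2 => b ⬝ᵥ u) fun a b => add_dotProduct a b u)
      (w := Pi.single i 1) (by simpa using hi)

/-! ### The symplectic form and the symplectic Fourier transform -/

/-- The symplectic form on the phase space. -/
def symp (n : ℕ) : LinearMap.BilinForm (ZMod 2) (Phase n) :=
  LinearMap.mk₂ (ZMod 2) (fun x y => x.1 ⬝ᵥ y.2 + x.2 ⬝ᵥ y.1)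
    (fun x x' y => by simp [add_dotProduct]; ring)
    (fun c x y => by simp [mul_add])
    (fun x y y' => by simp [dotProduct_add]; ring)
    (fun c x y => by simp [mul_add])

theorem symp_apply {n : ℕ} (x y : Phase n) : symp n x y = x.1 ⬝ᵥ y.2 + x.2 ⬝ᵥ y.1 := rfl

theorem symp_comm {n : ℕ} (x y : Phase n) : symp n x y = symp n y x := by
  rw [symp_apply, symp_apply, dotProduct_comm x.1, dotProduct_comm x.2, add_comm]

theorem symp_isRefl (n : ℕ) : (symp n).IsRefl := fun x y h => by rw [symp_comm, h]

theorem phase_add_self {n : ℕ} (x : Phase n) : x + x = 0 := by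
  ext i <;> simp [CharTwo.add_self_eq_zero]

theorem bits_add_self {n : ℕ} (x : Fin n → ZMod 2) : x + x = 0 := by
  ext i; simp [CharTwo.add_self_eq_zero]

theorem symp_separates {n : ℕ} {x : Phase n} (h : ∀ y, symp n x y = 0) : x = 0 := by
  refine Prod.ext (funext fun i => ?_) (funext fun i => ?_)
  · simpa [symp_apply] using h (0, Pi.single i 1)
  · simpa [symp_apply] using h (Pi.single i 1, 0)

theorem symp_nondegenerate (n : ℕ) : (symp n).Nondegenerate :=
  ⟨fun _ h => symp_separates h, fun x h => symp_separates fun y => by rw [symp_comm, h]⟩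

theorem sum_sgn_symp {n : ℕ} (x : Phase n) :
    ∑ y, sgn (symp n x y) = if x = 0 then 4 ^ n else 0 := by
  split_ifs with h
  · simp [h, ← mul_pow]
  · obtain ⟨y, hy⟩ : ∃ y, symp n x y ≠ 0 := by
      by_contra! h'
      exact h (symp_separates h')
    exact sum_sgn_eq_zero (symp n x).toAddMonoidHom (w := y) hy

/-- The symplectic Fourier transform. -/
def fourier {n : ℕ} (f : Phase n → ℝ) (y : Phase n) : ℝ := ∑ x, sgn (symp n x y) * f x

theorem fourier_fourier {n : ℕ} (f : Phase n → ℝ) (z : Phase n) :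
    fourier (fourier f) z = 4 ^ n * f z := by
  simp only [fourier, Finset.mul_sum]
  rw [Finset.sum_comm]
  have : ∀ x y : Phase n, sgn (symp n y z) * (sgn (symp n x y) * f x) =
      sgn (symp n (x + z) y) * f x := by
    intro x y
    rw [map_add, LinearMap.add_apply, sgn_add, symp_comm z y]
    ring
  simp only [this, ← Finset.sum_mul, sum_sgn_symp]
  rw [Finset.sum_eq_single z]
  · simp [phase_add_self]
  · intro x _ hx
    rw [if_neg, zero_mul]
    intro h
    apply hx
    rw [← add_zero x, ← phase_add_self z, ← add_assoc, h, zero_add]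
  · simp

theorem fourier_injective {n : ℕ} : Function.Injective (fourier (n := n)) := by
  intro f g h
  funext z
  have := congrFun (congrArg fourier h) z
  rw [fourier_fourier, fourier_fourier] at this
  exact mul_left_cancel₀ (by positivity) this

/-- Convolution on the phase space. -/
def conv {n : ℕ} (f : Phase n → ℝ) (x : Phase n) : ℝ := ∑ a, f a * f (x + a)

theorem fourier_conv {n : ℕ} (f : Phase n → ℝ) (y : Phase n) :
    fourier (conv f) y = fourier f y ^ 2 := by
  simp only [fourier, conv, Finset.mul_sum, sq]
  rw [Finset.sum_comm]
  refine Finset.sum_congr rfl fun a _ => ?_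
  rw [Finset.sum_mul, ← Equiv.sum_comp (Equiv.addRight a)]
  refine Finset.sum_congr rfl fun x _ => ?_
  simp only [Equiv.coe_addRight, map_add, LinearMap.add_apply, sgn_add, add_assoc, phase_add_self,
    add_zero]
  ring

/-! ### Weyl operators -/

/-- The phase factor of a Weyl operator. -/
noncomputable def phase {n : ℕ} (x : Phase n) : ℂ :=
  Complex.I ^ (∑ j, (x.1 j).val * (x.2 j).val)

@[simp] theorem norm_phase {n : ℕ} (x : Phase n) : ‖phase x‖ = 1 := by simp [phase]

theorem phase_mul_self {n : ℕ} (x : Phase n) : phase x * phase x = sgn (x.1 ⬝ᵥ x.2) := by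
  have : ∀ c d : ZMod 2, sgn (c * d) = (-1) ^ (c.val * d.val) := by
    intro c d
    rcases zmod_two_cases c with rfl | rfl <;> simp [sgn, ZMod.val_one]
  rw [phase, ← mul_pow, Complex.I_mul_I, dotProduct, sgn_sum]
  simp only [this]
  rw [Finset.prod_pow_eq_pow_sum]
  push_cast
  rfl

theorem weyl_apply {n : ℕ} (x : Phase n) (s t : Fin n → ZMod 2) :
    weyl x s t = phase x * if s = t + x.1 then (sgn (x.2 ⬝ᵥ t) : ℂ) else 0 := by
  have hj : ∀ a b s t : ZMod 2, (pauliX ^ a.val * pauliZ ^ b.val) s t =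
      if s = t + a then (sgn (b * t) : ℂ) else 0 := by
    intro a b s t
    rcases zmod_two_cases a with rfl | rfl <;> rcases zmod_two_cases b with rfl | rfl <;>
    rcases zmod_two_cases s with rfl | rfl <;> rcases zmod_two_cases t with rfl | rfl <;>
    simp [pauliX, pauliZ, ZMod.val_one, sgn, CharTwo.add_self_eq_zero] <;> rfl
  have : weyl x s t = phase x * ∏ j, (pauliX ^ (x.1 j).val * pauliZ ^ (x.2 j).val) (s j) (t j) :=
    rfl
  rw [this]
  congr 1
  simp only [hj]
  rw [Finset.prod_ite_zero, dotProduct, sgn_sum]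
  simp [funext_iff]

theorem weylApply_apply {n : ℕ} (x : Phase n) (ψ : Qubits n) (s : Fin n → ZMod 2) :
    weylApply x ψ s = phase x * (sgn (x.2 ⬝ᵥ (s + x.1)) * ψ (s + x.1)) := by
  have h : weylApply x ψ s = ∑ t : Fin n → ZMod 2, weyl x s t * ψ t := rfl
  rw [h, Finset.sum_eq_single (s + x.1)]
  · rw [weyl_apply, if_pos, mul_assoc]
    rw [add_assoc, bits_add_self, add_zero]
  · intro t _ ht
    rw [weyl_apply, if_neg, mul_zero, zero_mul]
    rintro rfl
    rw [add_assoc, bits_add_self, add_zero] at ht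
    exact ht rfl
  · simp

end StabTest

namespace StabTest

/-! ### Fourier transforms of the characteristic, Bell and Bell difference distributions -/

open ComplexConjugate

/-- The ambiguity function `∑ₛ (-1)^{s·v} ψ(s) conj ψ(s + u)` at `y = (u, v)`; up to a phase it is
`⟨ψ|W_y|ψ⟩`. -/
noncomputable def ambiguity {n : ℕ} (ψ : Qubits n) (y : Phase n) : ℂ :=
  ∑ s : Fin n → ZMod 2, (sgn (s ⬝ᵥ y.2) : ℂ) * (ψ s * conj (ψ (s + y.1)))

theorem sum_shift {n : ℕ} {E : Type*} [AddCommMonoid E] (a : Fin n → ZMod 2)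
    (f : (Fin n → ZMod 2) → E) : ∑ s, f (s + a) = ∑ s, f s :=
  Equiv.sum_comp (Equiv.addRight a) f

theorem bits_add_add_cancel {n : ℕ} (s a : Fin n → ZMod 2) : s + a + a = s := by
  rw [add_assoc, bits_add_self, add_zero]

theorem inner_qubits {n : ℕ} (φ ψ : Qubits n) :
    inner ℂ φ ψ = ∑ s : Fin n → ZMod 2, conj (φ s) * ψ s := by
  rw [PiLp.inner_apply]
  simp only [RCLike.inner_apply, mul_comm]
  rfl

theorem inner_weylApply {n : ℕ} (ψ : Qubits n) (y : Phase n) :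
    inner ℂ ψ (weylApply y ψ) = phase y * ambiguity ψ y := by
  rw [inner_qubits, ← sum_shift y.1, ambiguity, Finset.mul_sum]
  refine Finset.sum_congr rfl fun s _ => ?_
  rw [weylApply_apply, bits_add_add_cancel, dotProduct_comm]
  ring

theorem charDist_eq {n : ℕ} (ψ : Qubits n) (y : Phase n) :
    charDist ψ y = ‖ambiguity ψ y‖ ^ 2 / 2 ^ n := by
  rw [charDist, inner_weylApply, norm_mul, norm_phase, one_mul]

/-- The maximally entangled vector pairs the two copies bilinearly, so both factors of ψ appear
unconjugated, unlike in p_ψ. -/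
theorem bellProb_eq {n : ℕ} (ψ : Qubits n) (x : Phase n) :
    bellProb ψ x = ‖∑ t : Fin n → ZMod 2, (sgn (t ⬝ᵥ x.2) : ℂ) * (ψ (t + x.1) * ψ t)‖ ^ 2 / 2 ^ n := by
  have h : inner ℂ (bellState x) (tensor ψ ψ) =
      ∑ p : (Fin n → ZMod 2) × (Fin n → ZMod 2),
        conj (weyl x p.1 p.2 / (Real.sqrt (2 ^ n) : ℂ)) * (ψ p.1 * ψ p.2) := by
    rw [PiLp.inner_apply]
    simp only [RCLike.inner_apply, mul_comm]
    rfl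
  have h' : inner ℂ (bellState x) (tensor ψ ψ) = conj (phase x) / (Real.sqrt (2 ^ n) : ℂ) *
      ∑ t : Fin n → ZMod 2, (sgn (t ⬝ᵥ x.2) : ℂ) * (ψ (t + x.1) * ψ t) := by
    rw [h, Fintype.sum_prod_type_right, Finset.mul_sum]
    refine Finset.sum_congr rfl fun t _ => ?_
    rw [Finset.sum_eq_single (t + x.1)]
    · rw [weyl_apply, if_pos rfl, dotProduct_comm]
      simp
      ring
    · intro s _ hs
      rw [weyl_apply, if_neg hs]
      simp
    · simp
  rw [bellProb, h', norm_mul, norm_div, mul_pow, div_pow, RCLike.norm_conj, norm_phase,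
    Complex.norm_real, Real.norm_eq_abs, sq_abs, Real.sq_sqrt (by positivity)]
  ring

/-- The Wiener–Khinchin identity on bit strings. -/
theorem sum_sgn_normSq {n : ℕ} (f : (Fin n → ZMod 2) → ℂ) (u : Fin n → ZMod 2) :
    ∑ b : Fin n → ZMod 2, (sgn (b ⬝ᵥ u) : ℂ) *
      (((‖∑ t : Fin n → ZMod 2, (sgn (t ⬝ᵥ b) : ℂ) * f t‖ ^ 2 / 2 ^ n : ℝ)) : ℂ) =
    ∑ t, f t * conj (f (t + u)) := by
  have h1 : ∀ b : Fin n → ZMod 2, (sgn (b ⬝ᵥ u) : ℂ) *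
      (((‖∑ t : Fin n → ZMod 2, (sgn (t ⬝ᵥ b) : ℂ) * f t‖ ^ 2 / 2 ^ n : ℝ)) : ℂ) =
      ∑ t, ∑ t', (sgn (b ⬝ᵥ (u + t + t')) : ℂ) * (f t * conj (f t') / 2 ^ n) := by
    intro b
    push_cast
    rw [← Complex.mul_conj', map_sum, Finset.sum_mul_sum, Finset.sum_div, Finset.mul_sum]
    refine Finset.sum_congr rfl fun t _ => ?_
    rw [Finset.sum_div, Finset.mul_sum]
    refine Finset.sum_congr rfl fun t' _ => ?_
    rw [dotProduct_add, dotProduct_add, sgn_add, sgn_add, dotProduct_comm t, dotProduct_comm t']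
    simp
    ring
  simp only [h1]
  rw [Finset.sum_comm]
  refine Finset.sum_congr rfl fun t _ => ?_
  rw [Finset.sum_comm, Finset.sum_eq_single (t + u)]
  · have : u + t + (t + u) = 0 := by rw [add_comm u t, bits_add_self]
    simp [this]
    field_simp
  · intro t' _ ht'
    rw [← Finset.sum_mul, ← Complex.ofReal_sum, sum_sgn_dotProduct, if_neg]
    · simp
    · intro h
      apply ht'
      rw [add_comm u t] at h
      rw [← add_zero (t + u), ← bits_add_self t', ← add_assoc, h, zero_add]
  · simp

/-- The sum over b is the Wiener–Khinchin identity; the substitution a = s + t is made because the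
double sum then factors for both p_ψ and the Bell distribution. -/
theorem fourier_normSq {n : ℕ} {f : Phase n → ℝ} (F : (Fin n → ZMod 2) → (Fin n → ZMod 2) → ℂ)
    (hf : ∀ x, f x = ‖∑ t : Fin n → ZMod 2, (sgn (t ⬝ᵥ x.2) : ℂ) * F x.1 t‖ ^ 2 / 2 ^ n)
    (y : Phase n) :
    ((fourier f y : ℝ) : ℂ) =
      ∑ t, ∑ s, (sgn ((s + t) ⬝ᵥ y.2) : ℂ) * (F (s + t) t * conj (F (s + t) (t + y.1))) := by
  have h : ((fourier f y : ℝ) : ℂ) = ∑ a : Fin n → ZMod 2, (sgn (a ⬝ᵥ y.2) : ℂ) *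
      ∑ b : Fin n → ZMod 2, (sgn (b ⬝ᵥ y.1) : ℂ) * ((f (a, b) : ℝ) : ℂ) := by
    rw [fourier, Fintype.sum_prod_type]
    simp only [symp_apply, sgn_add, Complex.ofReal_sum, Complex.ofReal_mul, Finset.mul_sum,
      mul_assoc]
  simp only [hf, sum_sgn_normSq] at h
  rw [h]
  simp only [Finset.mul_sum]
  rw [Finset.sum_comm]
  refine Finset.sum_congr rfl fun t _ => ?_
  exact (sum_shift t fun a => (sgn (a ⬝ᵥ y.2) : ℂ) * (F a t * conj (F a (t + y.1)))).symm

theorem fourier_charDist {n : ℕ} (ψ : Qubits n) (y : Phase n) :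
    fourier (charDist ψ) y = ‖ambiguity ψ y‖ ^ 2 := by
  have h := fourier_normSq (fun a t => ψ t * conj (ψ (t + a))) (charDist_eq ψ) y
  have h' : ambiguity ψ y * conj (ambiguity ψ y) = ((fourier (charDist ψ) y : ℝ) : ℂ) := by
    rw [h, ambiguity, map_sum, Finset.sum_mul_sum]
    refine Finset.sum_congr rfl fun t _ => Finset.sum_congr rfl fun s _ => ?_
    have h1 : t + (s + t) = s := by rw [add_comm s t, ← add_assoc, bits_add_self, zero_add]
    have h2 : t + y.1 + (s + t) = s + y.1 := by rw [add_right_comm, h1]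
    rw [h1, h2, add_dotProduct, sgn_add]
    simp
    ring
  rw [Complex.mul_conj'] at h'
  exact_mod_cast h'.symm

/-- The double sum factors as for `fourier_charDist`, but without a conjugate on the second factor.
-/
theorem fourier_bellProb {n : ℕ} (ψ : Qubits n) (y : Phase n) :
    ((fourier (bellProb ψ) y : ℝ) : ℂ) = ambiguity ψ y ^ 2 := by
  rw [fourier_normSq (fun a t => ψ (t + a) * ψ t) (bellProb_eq ψ) y, sq, ambiguity,
    Finset.sum_mul_sum]
  refine Finset.sum_congr rfl fun t _ => Finset.sum_congr rfl fun s _ => ?_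
  have h1 : t + (s + t) = s := by rw [add_comm s t, ← add_assoc, bits_add_self, zero_add]
  have h2 : t + y.1 + (s + t) = s + y.1 := by rw [add_right_comm, h1]
  rw [h1, h2, add_dotProduct, sgn_add]
  simp
  ring

theorem bellDiffDist_eq_conv {n : ℕ} (ψ : Qubits n) : bellDiffDist ψ = conv (charDist ψ) := rfl

theorem fourier_bellDiffDist {n : ℕ} (ψ : Qubits n) (y : Phase n) :
    fourier (bellDiffDist ψ) y = ‖ambiguity ψ y‖ ^ 4 := by
  rw [bellDiffDist_eq_conv, fourier_conv, fourier_charDist]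
  ring

/-- Bell difference samples are distributed according to `q_ψ`. -/
theorem conv_bellProb {n : ℕ} (ψ : Qubits n) : conv (bellProb ψ) = bellDiffDist ψ := by
  apply fourier_injective
  funext y
  rw [fourier_conv, fourier_bellDiffDist]
  -- The transform is real and equals A(y)², so it is |A(y)|² up to a sign, which squaring removes.
  have h : |fourier (bellProb ψ) y| = ‖ambiguity ψ y‖ ^ 2 := by
    rw [← norm_pow, ← fourier_bellProb, Complex.norm_real, Real.norm_eq_abs]
  rw [← sq_abs, h]
  ring

theorem bellDiffDist_nonneg {n : ℕ} (ψ : Qubits n) (x : Phase n) : 0 ≤ bellDiffDist ψ x :=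
  Finset.sum_nonneg fun a _ => by unfold charDist; positivity

theorem ambiguity_zero {n : ℕ} {ψ : Qubits n} (hψ : ‖ψ‖ = 1) : ambiguity ψ 0 = 1 := by
  have h : inner ℂ ψ ψ = ambiguity ψ 0 := by
    rw [inner_qubits, ambiguity]
    refine Finset.sum_congr rfl fun s _ => ?_
    simp [mul_comm]
  rw [← h, inner_self_eq_norm_sq_to_K, hψ]
  simp

theorem sum_bellDiffDist {n : ℕ} {ψ : Qubits n} (hψ : ‖ψ‖ = 1) : ∑ x, bellDiffDist ψ x = 1 := by
  have h := fourier_bellDiffDist ψ 0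
  rw [ambiguity_zero hψ] at h
  simpa [fourier] using h

theorem norm_ambiguity_of_mem_weylGroup {n : ℕ} {ψ : Qubits n} (hψ : ‖ψ‖ = 1) {y : Phase n}
    (hy : y ∈ weylGroup ψ) : ‖ambiguity ψ y‖ = 1 := by
  have h : ‖inner ℂ ψ (weylApply y ψ)‖ = ‖ambiguity ψ y‖ := by
    rw [inner_weylApply, norm_mul, norm_phase, one_mul]
  rw [← h]
  rcases hy with hy | hy <;> rw [hy] <;> simp [hψ]

/-- The support of `q_ψ` is orthogonal to the stabilizer group of `ψ`. -/
theorem symp_eq_zero_of_mem_weylGroup {n : ℕ} {ψ : Qubits n} (hψ : ‖ψ‖ = 1) {x y : Phase n}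
    (hy : y ∈ weylGroup ψ) (hx : bellDiffDist ψ x ≠ 0) : symp n x y = 0 := by
  have h := fourier_bellDiffDist ψ y
  rw [norm_ambiguity_of_mem_weylGroup hψ hy, one_pow, ← sum_bellDiffDist hψ, fourier] at h
  have hle : ∀ x ∈ Finset.univ, sgn (symp n x y) * bellDiffDist ψ x ≤ bellDiffDist ψ x := by
    intro x _
    have := bellDiffDist_nonneg ψ x
    rcases sgn_eq (symp n x y) with h | h <;> rw [h] <;> linarith
  -- The signed and the unsigned sum of q_ψ agree, so they agree term by term.
  have := (Finset.sum_eq_sum_iff_of_le hle).1 h x (Finset.mem_univ x)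
  exact sgn_eq_one_iff.1 (mul_right_cancel₀ hx (by rw [this, one_mul]))

/-! ### Symplectic complements and the mass of a subspace -/

theorem finrank_phase (n : ℕ) : Module.finrank (ZMod 2) (Phase n) = 2 * n := by
  simp [two_mul]

/-- The orthogonal complement for the symplectic form. -/
def perp {n : ℕ} (S : Submodule (ZMod 2) (Phase n)) : Submodule (ZMod 2) (Phase n) :=
  (symp n).orthogonal S

theorem mem_perp {n : ℕ} {S : Submodule (ZMod 2) (Phase n)} {x : Phase n} :
    x ∈ perp S ↔ ∀ y ∈ S, symp n y x = 0 := Iff.rfl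

theorem perp_perp {n : ℕ} (S : Submodule (ZMod 2) (Phase n)) : perp (perp S) = S :=
  LinearMap.BilinForm.orthogonal_orthogonal (symp_nondegenerate n) (symp_isRefl n) S

theorem finrank_perp {n : ℕ} (S : Submodule (ZMod 2) (Phase n)) :
    Module.finrank (ZMod 2) (perp S) = 2 * n - Module.finrank (ZMod 2) S := by
  rw [perp, LinearMap.BilinForm.finrank_orthogonal (symp_nondegenerate n),
    finrank_phase]

theorem finrank_le {n : ℕ} (S : Submodule (ZMod 2) (Phase n)) :
    Module.finrank (ZMod 2) S ≤ 2 * n := by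
  rw [← finrank_phase]
  exact S.finrank_le

open scoped Classical in
/-- The weight of a subspace under `q_ψ` is the average of `⟨ψ|W_y|ψ⟩⁴` over its complement. -/
theorem sum_bellDiffDist_perp {n : ℕ} (ψ : Qubits n) (T : Submodule (ZMod 2) (Phase n)) :
    (Fintype.card T : ℝ) * ∑ x, (if x ∈ perp T then bellDiffDist ψ x else 0) =
      ∑ y : T, ‖ambiguity ψ y‖ ^ 4 := by
  simp only [← fourier_bellDiffDist, fourier]
  rw [Finset.sum_comm, Finset.mul_sum]
  refine Finset.sum_congr rfl fun x _ => ?_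
  rw [← Finset.sum_mul]
  split_ifs with h
  · have : ∀ y : T, sgn (symp n x y) = 1 := fun y => by
      rw [symp_comm, mem_perp.1 h y y.2, sgn_zero]
    simp [this]
  · rw [mem_perp] at h
    push Not at h
    obtain ⟨y, hy, hxy⟩ := h
    have h0 : ∑ y : T, sgn (symp n x y) = 0 :=
      sum_sgn_eq_zero ((symp n x).toAddMonoidHom.comp T.subtype.toAddMonoidHom)
        (w := ⟨y, hy⟩) (by simpa [symp_comm x] using hxy)
    rw [mul_zero, h0, zero_mul]

end StabTest

namespace StabTest

/-! ### The span of independent samples -/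

theorem sum_fin_succ_pi {m : ℕ} {α E : Type*} [Fintype α] [AddCommMonoid E]
    (f : (Fin (m + 1) → α) → E) : ∑ x, f x = ∑ a, ∑ x : Fin m → α, f (Fin.cons a x) := by
  rw [← Equiv.sum_comp (Fin.consEquiv fun _ : Fin (m + 1) => α) f, Fintype.sum_prod_type]
  rfl

open scoped Classical in
/-- The mass that a weight function gives to a subspace. -/
noncomputable def mass {V : Type*} [AddCommGroup V] [Module (ZMod 2) V] [Fintype V] (q : V → ℝ)
    (S : Submodule (ZMod 2) V) : ℝ := ∑ x, if x ∈ S then q x else 0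

-- A sample outside S at least halves 2^(-dim S), and while the mass of S is at most 1 - ε this has
-- probability at least ε. Once the mass exceeds 1 - ε it stays so, and the event is impossible. The
-- starting subspace is arbitrary so that the induction can absorb the first sample into it.
open scoped Classical in
theorem sum_span_mass_le {V : Type*} [AddCommGroup V] [Module (ZMod 2) V] [Fintype V] {q : V → ℝ}
    (hq : ∀ x, 0 ≤ q x) (hq1 : ∑ x, q x = 1) {ε : ℝ} (hε : ε ≤ 1) (m : ℕ) :
    ∀ S : Submodule (ZMod 2) V,
    ∑ x : Fin m → V, (if mass q (S ⊔ Submodule.span (ZMod 2) (Set.range x)) ≤ 1 - ε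
      then ∏ i, q (x i) else 0) ≤
    2 ^ Module.finrank (ZMod 2) V / 2 ^ Module.finrank (ZMod 2) S * (1 - ε / 2) ^ m := by
  have hmono : ∀ S S' : Submodule (ZMod 2) V, S ≤ S' → mass q S ≤ mass q S' := by
    intro S S' h
    refine Finset.sum_le_sum fun x _ => ?_
    by_cases hx : x ∈ S
    · rw [if_pos hx, if_pos (h hx)]
    · rw [if_neg hx]
      split_ifs
      exacts [hq x, le_rfl]
  have hc : (0 : ℝ) ≤ 1 - ε / 2 := by linarith
  induction m with
  | zero =>
    intro S
    have : (1 : ℝ) ≤ 2 ^ Module.finrank (ZMod 2) V / 2 ^ Module.finrank (ZMod 2) S := by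
      rw [one_le_div (by positivity)]
      exact pow_le_pow_right₀ (by norm_num) S.finrank_le
    simp only [Fintype.sum_unique, Finset.univ_eq_empty, Finset.prod_empty, pow_zero, mul_one]
    split_ifs
    exacts [this, by linarith]
  | succ m ih =>
    intro S
    set D := Module.finrank (ZMod 2) V
    set r := Module.finrank (ZMod 2) S
    by_cases hS : mass q S ≤ 1 - ε
    · have hstep : ∀ a : V, ∑ x : Fin m → V,
          (if mass q (S ⊔ Submodule.span (ZMod 2) (Set.range (Fin.cons a x : Fin (m + 1) → V))) ≤ 1 - ε
            then ∏ i, q ((Fin.cons a x : Fin (m + 1) → V) i) else 0) ≤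
          (2 ^ D / 2 ^ r * (1 - ε / 2) ^ m) * ((q a + if a ∈ S then q a else 0) / 2) := by
        intro a
        have h1 : ∀ x : Fin m → V,
            (if mass q (S ⊔ Submodule.span (ZMod 2)
                (Set.range (Fin.cons a x : Fin (m + 1) → V))) ≤ 1 - ε
              then ∏ i, q ((Fin.cons a x : Fin (m + 1) → V) i) else 0) =
            q a * (if mass q ((S ⊔ Submodule.span (ZMod 2) {a}) ⊔
                Submodule.span (ZMod 2) (Set.range x)) ≤ 1 - ε
              then ∏ i, q (x i) else 0) := by
          intro x
          rw [Fin.range_cons, Submodule.span_insert, ← sup_assoc, Fin.prod_univ_succ]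
          simp
        simp only [h1]
        rw [← Finset.mul_sum]
        refine (mul_le_mul_of_nonneg_left (ih _) (hq a)).trans ?_
        by_cases ha : a ∈ S
        · have : S ⊔ Submodule.span (ZMod 2) {a} = S := by simpa using ha
          rw [this, if_pos ha]
          apply le_of_eq
          ring
        · have hlt : r < Module.finrank (ZMod 2) ↥(S ⊔ Submodule.span (ZMod 2) {a}) := by
            apply Submodule.finrank_lt_finrank_of_lt
            exact left_lt_sup.2 (by simpa using ha)
          have h2 : (2 : ℝ) ^ D / 2 ^ Module.finrank (ZMod 2) ↥(S ⊔ Submodule.span (ZMod 2) {a}) ≤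
              2 ^ D / 2 ^ (r + 1) :=
            div_le_div_of_nonneg_left (by positivity) (by positivity)
              (pow_le_pow_right₀ (by norm_num) hlt)
          rw [if_neg ha]
          calc _ ≤ q a * (2 ^ D / 2 ^ (r + 1) * (1 - ε / 2) ^ m) :=
                mul_le_mul_of_nonneg_left (mul_le_mul_of_nonneg_right h2 (by positivity)) (hq a)
            _ = _ := by rw [pow_succ]; field_simp; ring
      rw [sum_fin_succ_pi]
      -- Averaging over the first sample leaves the factor (1 + mass)/2, at most 1 - ε/2 by `hS`.
      refine (Finset.sum_le_sum fun a _ => hstep a).trans ?_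
      rw [← Finset.mul_sum, ← Finset.sum_div, Finset.sum_add_distrib, hq1, pow_succ, ← mul_assoc]
      refine mul_le_mul_of_nonneg_left ?_ (by positivity)
      have : mass q S = ∑ x, if x ∈ S then q x else 0 := rfl
      linarith
    · rw [Finset.sum_eq_zero]
      · positivity
      · intro x _
        rw [if_neg]
        intro h
        exact hS ((hmono _ _ le_sup_left).trans h)

end StabTest

open ComplexConjugate

namespace StabTest

/-! ### The algebra of Weyl operators -/

variable {n : ℕ}

theorem weylApply_add (x : Phase n) (ψ φ : Qubits n) :
    weylApply x (ψ + φ) = weylApply x ψ + weylApply x φ := map_add _ _ _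

theorem weylApply_sub (x : Phase n) (ψ φ : Qubits n) :
    weylApply x (ψ - φ) = weylApply x ψ - weylApply x φ := map_sub _ _ _

theorem weylApply_smul (x : Phase n) (c : ℂ) (ψ : Qubits n) :
    weylApply x (c • ψ) = c • weylApply x ψ := map_smul _ _ _

theorem conj_phase_mul (x : Phase n) : conj (phase x) * phase x = 1 := by
  rw [Complex.conj_mul', norm_phase]
  simp

theorem qubits_smul_apply (c : ℂ) (ψ : Qubits n) (s : Fin n → ZMod 2) : (c • ψ) s = c * ψ s := rfl

/-- The phase factors are symmetric in x and y, so only the sign depends on the order;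
`weylApply_comm` rests on this. -/
theorem weylApply_weylApply (x y : Phase n) (ψ : Qubits n) :
    weylApply x (weylApply y ψ) =
      (phase x * phase y * conj (phase (x + y)) * (sgn (x.2 ⬝ᵥ y.1) : ℂ)) • weylApply (x + y) ψ := by
  refine PiLp.ext fun s : Fin n → ZMod 2 => ?_
  rw [qubits_smul_apply, weylApply_apply, weylApply_apply, weylApply_apply]
  simp only [Prod.fst_add, Prod.snd_add, add_assoc]
  have h : (sgn (x.2 ⬝ᵥ (s + x.1)) : ℂ) = sgn (x.2 ⬝ᵥ y.1) * sgn (x.2 ⬝ᵥ (s + (x.1 + y.1))) := by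
    rw [← add_assoc, dotProduct_add x.2 (s + x.1), sgn_add]
    push_cast
    have : (sgn (x.2 ⬝ᵥ y.1) : ℂ) * sgn (x.2 ⬝ᵥ y.1) = 1 := by exact_mod_cast sgn_mul_self _
    linear_combination (-(sgn (x.2 ⬝ᵥ (s + x.1)) : ℂ)) * this
  rw [h, add_dotProduct, sgn_add]
  push_cast
  linear_combination (-(phase x * phase y * sgn (x.2 ⬝ᵥ y.1) * sgn (x.2 ⬝ᵥ (s + (x.1 + y.1))) *
    sgn (y.2 ⬝ᵥ (s + (x.1 + y.1))) * ψ (s + (x.1 + y.1)))) * conj_phase_mul (x + y)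

theorem weylApply_zero (ψ : Qubits n) : weylApply 0 ψ = ψ := by
  refine PiLp.ext fun s : Fin n → ZMod 2 => ?_
  rw [weylApply_apply]
  simp [phase]

theorem weylApply_self (x : Phase n) (ψ : Qubits n) : weylApply x (weylApply x ψ) = ψ := by
  rw [weylApply_weylApply, phase_add_self, weylApply_zero, phase_mul_self, dotProduct_comm x.2]
  have : (sgn (x.1 ⬝ᵥ x.2) : ℂ) * sgn (x.1 ⬝ᵥ x.2) = 1 := by exact_mod_cast sgn_mul_self _
  simp [phase, this]

theorem weylApply_comm (x y : Phase n) (ψ : Qubits n) :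
    weylApply x (weylApply y ψ) = (sgn (symp n x y) : ℂ) • weylApply y (weylApply x ψ) := by
  rw [weylApply_weylApply, weylApply_weylApply, smul_smul, add_comm y x, symp_apply, sgn_add,
    dotProduct_comm x.1 y.2]
  congr 1
  have : (sgn (y.2 ⬝ᵥ x.1) : ℂ) * sgn (y.2 ⬝ᵥ x.1) = 1 := by exact_mod_cast sgn_mul_self _
  push_cast
  linear_combination (-(phase x * phase y * conj (phase (x + y)) * (sgn (x.2 ⬝ᵥ y.1) : ℂ))) * this

theorem norm_inner_weylApply (x : Phase n) (ψ : Qubits n) :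
    ‖inner ℂ ψ (weylApply x ψ)‖ = ‖ambiguity ψ x‖ := by
  rw [inner_weylApply, norm_mul, norm_phase, one_mul]

theorem norm_inner_weylApply_weylApply (x y : Phase n) (ψ : Qubits n) :
    ‖inner ℂ ψ (weylApply x (weylApply y ψ))‖ = ‖ambiguity ψ (x + y)‖ := by
  rw [weylApply_weylApply, inner_smul_right, norm_mul, norm_inner_weylApply]
  have : ‖(sgn (x.2 ⬝ᵥ y.1) : ℂ)‖ = 1 := by
    rcases sgn_eq (x.2 ⬝ᵥ y.1) with h | h <;> simp [h]
  rw [norm_mul, norm_mul, norm_mul, this, RCLike.norm_conj]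
  simp

/-- Weyl operators are Hermitian: conjugating the factor i^(a'·b') gives the sign (-1)^(a·b), which
compensates the one from exchanging X^a and Z^b. -/
theorem inner_weylApply_left (x : Phase n) (φ ψ : Qubits n) :
    inner ℂ (weylApply x φ) ψ = inner ℂ φ (weylApply x ψ) := by
  rw [inner_qubits, inner_qubits, ← sum_shift x.1]
  refine Finset.sum_congr rfl fun s _ => ?_
  rw [weylApply_apply, weylApply_apply, bits_add_add_cancel, dotProduct_add, sgn_add]
  have h : conj (phase x) = phase x * sgn (x.2 ⬝ᵥ x.1) := by
    have h1 := conj_phase_mul x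
    have h2 := phase_mul_self x
    rw [dotProduct_comm] at h2
    rw [← h2]
    have : (sgn (x.2 ⬝ᵥ x.1) : ℂ) * sgn (x.2 ⬝ᵥ x.1) = 1 := by exact_mod_cast sgn_mul_self _
    rw [← h2] at this
    linear_combination (-conj (phase x)) * this + (phase x * phase x * phase x) * h1
  simp only [map_mul, Complex.conj_ofReal, h]
  push_cast
  ring

theorem norm_weylApply (x : Phase n) (ψ : Qubits n) : ‖weylApply x ψ‖ = ‖ψ‖ := by
  have h : inner ℂ (weylApply x ψ) (weylApply x ψ) = inner ℂ ψ ψ := by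
    rw [inner_weylApply_left, weylApply_self]
  rw [inner_self_eq_norm_sq_to_K, inner_self_eq_norm_sq_to_K] at h
  have h' : ‖weylApply x ψ‖ ^ 2 = ‖ψ‖ ^ 2 := by exact_mod_cast h
  exact (sq_eq_sq₀ (norm_nonneg _) (norm_nonneg _)).1 h'

/-- The uncertainty relation for anticommuting Weyl operators. -/
theorem sq_ambiguity_add_sq_le {ψ : Qubits n} (hψ : ‖ψ‖ = 1) {x y : Phase n}
    (h : symp n x y ≠ 0) : ‖ambiguity ψ x‖ ^ 2 + ‖ambiguity ψ y‖ ^ 2 ≤ 1 := by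
  have hreal : ∀ z : Phase n, ∃ r : ℝ, inner ℂ ψ (weylApply z ψ) = (r : ℂ) := by
    intro z
    have : conj (inner ℂ ψ (weylApply z ψ)) = inner ℂ ψ (weylApply z ψ) := by
      rw [inner_conj_symm, inner_weylApply_left]
    exact ⟨_, (Complex.conj_eq_iff_re.1 this).symm⟩
  obtain ⟨a, ha⟩ := hreal x
  obtain ⟨b, hb⟩ := hreal y
  rw [← norm_inner_weylApply, ← norm_inner_weylApply, ha, hb, Complex.norm_real, Complex.norm_real,
    Real.norm_eq_abs, Real.norm_eq_abs, sq_abs, sq_abs]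
  -- Anticommutation makes this inner product imaginary. Hence v = a W_x ψ + b W_y ψ has ‖v‖² = a² +
  -- b² = ⟨ψ|v⟩, and Cauchy–Schwarz gives (a² + b²)² ≤ a² + b².
  have hp : (inner ℂ (weylApply x ψ) (weylApply y ψ)).re = 0 := by
    have h1 : conj (inner ℂ (weylApply x ψ) (weylApply y ψ)) =
        -inner ℂ (weylApply x ψ) (weylApply y ψ) := by
      rw [inner_conj_symm, inner_weylApply_left, inner_weylApply_left, weylApply_comm x y,
        (zmod_two_cases _).resolve_left h]
      simp
    have := congrArg Complex.re h1
    simp only [Complex.conj_re, Complex.neg_re] at this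
    linarith
  have hv : ‖(a : ℂ) • weylApply x ψ + (b : ℂ) • weylApply y ψ‖ ^ 2 = a ^ 2 + b ^ 2 := by
    rw [norm_add_sq (𝕜 := ℂ), inner_smul_left, inner_smul_right, norm_smul, norm_smul,
      norm_weylApply, norm_weylApply, hψ]
    simp [hp]
  have hi : inner ℂ ψ ((a : ℂ) • weylApply x ψ + (b : ℂ) • weylApply y ψ) =
      ((a ^ 2 + b ^ 2 : ℝ) : ℂ) := by
    rw [inner_add_right, inner_smul_right, inner_smul_right, ha, hb]
    push_cast
    ring
  have hcs := norm_inner_le_norm (𝕜 := ℂ) ψ ((a : ℂ) • weylApply x ψ + (b : ℂ) • weylApply y ψ)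
  rw [hi, hψ, one_mul, Complex.norm_real, Real.norm_eq_abs, abs_of_nonneg (by positivity)] at hcs
  have := pow_le_pow_left₀ (by positivity) hcs 2
  rw [hv] at this
  nlinarith [sq_nonneg a, sq_nonneg b]

/-- If the average of `⟨ψ|W_y|ψ⟩⁴` over a subspace exceeds `5/8`, then the subspace is isotropic. -/
theorem isotropic_of_sum_ambiguity {ψ : Qubits n} (hψ : ‖ψ‖ = 1)
    (T : Submodule (ZMod 2) (Phase n)) [Fintype T]
    (h : 5 / 8 * (Fintype.card T : ℝ) < ∑ y : T, ‖ambiguity ψ y‖ ^ 4) :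
    ∀ x ∈ T, ∀ y ∈ T, symp n x y = 0 := by
  classical
  let M : Finset T := Finset.univ.filter fun y => 1 / 2 < ‖ambiguity ψ y‖ ^ 2
  have hle1 : ∀ y : Phase n, ‖ambiguity ψ y‖ ≤ 1 := by
    intro y
    rw [← norm_inner_weylApply]
    refine (norm_inner_le_norm _ _).trans ?_
    rw [norm_weylApply, hψ, one_mul]
  -- Fourth powers are at most 1 on M and 1/4 off it, so the average is at most 1/4 + (3/4)|M|/|T|;
  -- exceeding 5/8 forces |M| > |T|/2.
  have hM : (Fintype.card T : ℝ) < 2 * M.card := by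
    have h1 : ∑ y : T, ‖ambiguity ψ y‖ ^ 4 ≤ ∑ y : T, (1 / 4 + if y ∈ M then (3 / 4 : ℝ) else 0) := by
      refine Finset.sum_le_sum fun y _ => ?_
      split_ifs with hy
      · have := pow_le_one₀ (n := 4) (norm_nonneg _) (hle1 y)
        linarith
      · simp only [M, Finset.mem_filter, Finset.mem_univ, true_and, not_lt] at hy
        nlinarith [sq_nonneg ‖ambiguity ψ y‖]
    rw [Finset.sum_add_distrib, ← Finset.sum_filter] at h1
    simp at h1
    linarith
  have hM' : Fintype.card T < 2 * M.card := by exact_mod_cast hM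
  have hcomm : ∀ x ∈ M, ∀ y ∈ M, symp n x y = 0 := by
    intro x hx y hy
    by_contra hne
    have := sq_ambiguity_add_sq_le hψ hne
    simp only [M, Finset.mem_filter, Finset.mem_univ, true_and] at hx hy
    linarith
  -- M and t + M each fill more than half of T, so they meet.
  have hgen : ∀ t : T, ∃ a ∈ M, ∃ b ∈ M, t = a + b := by
    intro t
    have : ¬ Disjoint M (M.map (Equiv.addLeft t).toEmbedding) := by
      intro hd
      have := Finset.card_le_univ (M ∪ M.map (Equiv.addLeft t).toEmbedding)
      rw [Finset.card_union_of_disjoint hd, Finset.card_map] at this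
      omega
    obtain ⟨a, ha, ha'⟩ := Finset.not_disjoint_iff.1 this
    obtain ⟨b, hb, rfl⟩ := Finset.mem_map.1 ha'
    refine ⟨_, ha, b, hb, Subtype.ext ?_⟩
    simp [add_assoc, phase_add_self]
  intro x hx y hy
  obtain ⟨a, ha, b, hb, hab⟩ := hgen ⟨x, hx⟩
  obtain ⟨c, hc, d, hd, hcd⟩ := hgen ⟨y, hy⟩
  have hab' : x = a + b := congrArg Subtype.val hab
  have hcd' : y = c + d := congrArg Subtype.val hcd
  rw [hab', hcd']
  simp [hcomm _ ha _ hc, hcomm _ ha _ hd, hcomm _ hb _ hc, hcomm _ hb _ hd]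

end StabTest

namespace StabTest

/-! ### Projecting onto a stabilizer code -/

variable {n : ℕ}

theorem sum_zmod_two {E : Type*} [AddCommMonoid E] (f : ZMod 2 → E) : ∑ c, f c = f 0 + f 1 :=
  Fin.sum_univ_two f

/-- The projection of `ψ` onto the eigenspace of `W_y` for the eigenvalue `σ = ±1`. -/
noncomputable def halfProj (y : Phase n) (σ : ℂ) (ψ : Qubits n) : Qubits n :=
  (1 / 2 : ℂ) • (ψ + σ • weylApply y ψ)

theorem weylApply_halfProj {σ : ℂ} (hσ : σ * σ = 1) (y : Phase n) (ψ : Qubits n) :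
    weylApply y (halfProj y σ ψ) = σ • halfProj y σ ψ := by
  simp only [halfProj, weylApply_smul, weylApply_add, weylApply_self]
  rw [smul_comm σ, smul_add σ, smul_smul σ σ, hσ, one_smul, add_comm (σ • ψ), smul_add]

theorem inner_eq_zero_of_weylApply {y : Phase n} {φ χ : Qubits n} {σ : ℂ} (hσ : σ = 1 ∨ σ = -1)
    (hφ : weylApply y φ = σ • φ) (hχ : weylApply y χ = -σ • χ) : inner ℂ φ χ = 0 := by
  have h := inner_weylApply_left y φ χ
  rw [hφ, hχ, inner_smul_left, inner_smul_right] at h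
  rcases hσ with rfl | rfl <;> simp at h
  · linear_combination (1 / 2 : ℂ) * h
  · linear_combination (-1 / 2 : ℂ) * h

/-- For pairwise commuting Weyl operators, some joint eigenvector projection of `ψ` is at least as
long as the average of `⟨ψ|W_x|ψ⟩²` over the group that they generate. -/
theorem exists_joint_eigenvector (d : ℕ) : ∀ (y : Fin d → Phase n)
    (_ : ∀ i j, symp n (y i) (y j) = 0) (ψ : Qubits n), ∃ φ : Qubits n,
      (∀ i, weylApply (y i) φ = φ ∨ weylApply (y i) φ = -φ) ∧
      (∀ z, (∀ i, symp n z (y i) = 0) → ∀ c : ℂ, weylApply z ψ = c • ψ → weylApply z φ = c • φ) ∧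
      inner ℂ φ ψ = ((‖φ‖ ^ 2 : ℝ) : ℂ) ∧
      ∑ c : Fin d → ZMod 2, ‖inner ℂ ψ (weylApply (∑ i, c i • y i) ψ)‖ ^ 2 ≤
        2 ^ d * (‖φ‖ ^ 2 * ‖ψ‖ ^ 2) := by
  induction d with
  | zero =>
    intro y _ ψ
    refine ⟨ψ, fun i => i.elim0, fun z _ c h => h, ?_, ?_⟩
    · rw [inner_self_eq_norm_sq_to_K]
      simp
    · simp only [Fintype.sum_unique, Finset.univ_eq_empty, Finset.sum_empty, weylApply_zero,
        inner_self_eq_norm_sq_to_K]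
      simp
      apply le_of_eq
      ring
  | succ d ih =>
    intro y hy ψ
    have hcomm : ∀ z, symp n z (y 0) = 0 → ∀ φ, weylApply z (weylApply (y 0) φ) =
        weylApply (y 0) (weylApply z φ) := by
      intro z hz φ
      rw [weylApply_comm, hz, sgn_zero]
      simp
    have hS : ∀ z, symp n z (y 0) = 0 → ∀ σ, weylApply z (halfProj (y 0) σ ψ) =
        halfProj (y 0) σ (weylApply z ψ) := by
      intro z hz σ
      simp only [halfProj, weylApply_smul, weylApply_add, hcomm z hz]
    have hsum : halfProj (y 0) 1 ψ + halfProj (y 0) (-1) ψ = ψ := by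
      simp only [halfProj]
      module
    have hdiff : halfProj (y 0) 1 ψ - halfProj (y 0) (-1) ψ = weylApply (y 0) ψ := by
      simp only [halfProj]
      module
    set ψp := halfProj (y 0) 1 ψ
    set ψm := halfProj (y 0) (-1) ψ
    have hp : weylApply (y 0) ψp = (1 : ℂ) • ψp := weylApply_halfProj (by norm_num) _ _
    have hm : weylApply (y 0) ψm = (-1 : ℂ) • ψm := weylApply_halfProj (by norm_num) _ _
    have hnorm : ‖ψ‖ ^ 2 = ‖ψp‖ ^ 2 + ‖ψm‖ ^ 2 := by
      rw [← hsum, norm_add_sq (𝕜 := ℂ), inner_eq_zero_of_weylApply (Or.inl rfl) hp hm]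
      simp
    -- The cross terms vanish, so x and y₀ + x contribute |u + v|² and |u - v|², where u and v are
    -- the expectations of W_x in the two halves; the parallelogram law adds them up.
    have hE : ∑ c : Fin (d + 1) → ZMod 2, ‖inner ℂ ψ (weylApply (∑ i, c i • y i) ψ)‖ ^ 2 =
        2 * (∑ c : Fin d → ZMod 2, ‖inner ℂ ψp (weylApply (∑ i, c i • y i.succ) ψp)‖ ^ 2 +
          ∑ c : Fin d → ZMod 2, ‖inner ℂ ψm (weylApply (∑ i, c i • y i.succ) ψm)‖ ^ 2) := by
      rw [sum_fin_succ_pi, sum_zmod_two, ← Finset.sum_add_distrib, ← Finset.sum_add_distrib,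
        Finset.mul_sum]
      refine Finset.sum_congr rfl fun c _ => ?_
      simp only [Fin.sum_univ_succ, Fin.cons_zero, Fin.cons_succ, zero_smul, one_smul, zero_add]
      set x := ∑ i, c i • y i.succ
      have hx : symp n x (y 0) = 0 := by
        simp [x, hy]
      have hxp : weylApply (y 0) (weylApply x ψp) = (1 : ℂ) • weylApply x ψp := by
        rw [← hcomm x hx, hp, weylApply_smul]
      have hxm : weylApply (y 0) (weylApply x ψm) = (-1 : ℂ) • weylApply x ψm := by
        rw [← hcomm x hx, hm, weylApply_smul]
      have h0 : inner ℂ ψp (weylApply x ψm) = 0 :=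
        inner_eq_zero_of_weylApply (Or.inl rfl) hp hxm
      have h0' : inner ℂ ψm (weylApply x ψp) = 0 :=
        inner_eq_zero_of_weylApply (Or.inr rfl) hm (by simpa using hxp)
      have h1 : inner ℂ ψ (weylApply x ψ) =
          inner ℂ ψp (weylApply x ψp) + inner ℂ ψm (weylApply x ψm) := by
        rw [← hsum, weylApply_add, inner_add_left, inner_add_right, inner_add_right, h0, h0']
        ring
      have h2 : ‖inner ℂ ψ (weylApply (y 0 + x) ψ)‖ =
          ‖inner ℂ ψp (weylApply x ψp) - inner ℂ ψm (weylApply x ψm)‖ := by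
        rw [norm_inner_weylApply, add_comm, ← norm_inner_weylApply_weylApply, ← hdiff,
          weylApply_sub]
        congr 1
        conv_lhs => rw [← hsum]
        rw [inner_add_left, inner_sub_right, inner_sub_right, h0, h0']
        ring
      rw [h1, h2]
      have := parallelogram_law_with_norm ℝ (inner ℂ ψp (weylApply x ψp))
        (inner ℂ ψm (weylApply x ψm))
      linarith
    have hfin : ∀ (σ : ℂ) (χ χ' : Qubits n), (σ = 1 ∨ σ = -1) → χ = halfProj (y 0) σ ψ →
        χ + χ' = ψ → weylApply (y 0) χ = σ • χ → weylApply (y 0) χ' = -σ • χ' →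
        ∀ φ : Qubits n, (∀ i : Fin d, weylApply (y i.succ) φ = φ ∨ weylApply (y i.succ) φ = -φ) →
        (∀ z, (∀ i : Fin d, symp n z (y i.succ) = 0) → ∀ c : ℂ, weylApply z χ = c • χ →
          weylApply z φ = c • φ) → inner ℂ φ χ = ((‖φ‖ ^ 2 : ℝ) : ℂ) →
        (∀ i, weylApply (y i) φ = φ ∨ weylApply (y i) φ = -φ) ∧
        (∀ z, (∀ i, symp n z (y i) = 0) → ∀ c : ℂ, weylApply z ψ = c • ψ →
          weylApply z φ = c • φ) ∧ inner ℂ φ ψ = ((‖φ‖ ^ 2 : ℝ) : ℂ) := by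
      intro σ χ χ' hσ hχ hadd hχ1 hχ2 φ f1 f2 f3
      -- The inheritance clause of the induction is there for this: projecting further does not lose
      -- the eigenvalue of the first operator.
      have hφ : weylApply (y 0) φ = σ • φ := f2 (y 0) (fun i => hy _ _) σ hχ1
      refine ⟨fun i => ?_, fun z hz c hc => ?_, ?_⟩
      · refine Fin.cases ?_ f1 i
        rcases hσ with rfl | rfl <;> simp [hφ]
      · refine f2 z (fun i => hz _) c ?_
        rw [hχ, hS z (hz 0), hc]
        simp only [halfProj, weylApply_smul]
        module
      · rw [← hadd, inner_add_right, f3, inner_eq_zero_of_weylApply hσ hφ hχ2, add_zero]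
    obtain ⟨φp, p1, p2, p3, p4⟩ := ih (fun i => y i.succ) (fun i j => hy _ _) ψp
    obtain ⟨φm, m1, m2, m3, m4⟩ := ih (fun i => y i.succ) (fun i j => hy _ _) ψm
    -- B will be the larger of the two squared lengths, and ‖ψ‖² splits as ‖ψp‖² + ‖ψm‖².
    have key : ∀ B : ℝ, ‖φp‖ ^ 2 ≤ B → ‖φm‖ ^ 2 ≤ B →
        ∑ c : Fin (d + 1) → ZMod 2, ‖inner ℂ ψ (weylApply (∑ i, c i • y i) ψ)‖ ^ 2 ≤
          2 ^ (d + 1) * (B * ‖ψ‖ ^ 2) := by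
      intro B hB1 hB2
      rw [hE, hnorm]
      have q1 : (2 : ℝ) ^ d * (‖φp‖ ^ 2 * ‖ψp‖ ^ 2) ≤ 2 ^ d * (B * ‖ψp‖ ^ 2) := by gcongr
      have q2 : (2 : ℝ) ^ d * (‖φm‖ ^ 2 * ‖ψm‖ ^ 2) ≤ 2 ^ d * (B * ‖ψm‖ ^ 2) := by gcongr
      rw [pow_succ]
      linarith
    rcases le_total (‖φm‖ ^ 2) (‖φp‖ ^ 2) with hle | hle
    · obtain ⟨r1, r2, r3⟩ := hfin 1 ψp ψm (Or.inl rfl) rfl hsum hp hm φp p1 p2 p3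
      exact ⟨φp, r1, r2, r3, key _ le_rfl hle⟩
    · obtain ⟨r1, r2, r3⟩ := hfin (-1) ψm ψp (Or.inr rfl) rfl (by rw [add_comm]; exact hsum) hm
        (by simpa using hp) φm m1 m2 m3
      exact ⟨φm, r1, r2, r3, key _ hle le_rfl⟩

/-- A state for which the average of `⟨ψ|W_y|ψ⟩⁴` over a `d`-dimensional subspace exceeds `5/8` has
at least that fidelity with a state of stabilizer dimension at least `d`. -/
theorem exists_fidelity_ge {ψ : Qubits n} (hψ : ‖ψ‖ = 1) (T : Submodule (ZMod 2) (Phase n))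
    [Fintype T] {μ : ℝ} (hμ : 5 / 8 < μ)
    (h : μ * (Fintype.card T : ℝ) ≤ ∑ y : T, ‖ambiguity ψ y‖ ^ 4) :
    ∃ φ : Qubits n, ‖φ‖ = 1 ∧ Module.finrank (ZMod 2) T ≤ stabDim φ ∧ μ ≤ fidelity ψ φ := by
  have hcard : (0 : ℝ) < Fintype.card T := by exact_mod_cast Fintype.card_pos
  have hiso := isotropic_of_sum_ambiguity hψ T (by nlinarith)
  set d := Module.finrank (ZMod 2) T
  let b : Module.Basis (Fin d) (ZMod 2) T := Module.finBasis (ZMod 2) T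
  obtain ⟨φ, h1, -, h3, h4⟩ := exists_joint_eigenvector d (fun i => (b i : Phase n))
    (fun i j => hiso _ (b i).2 _ (b j).2) ψ
  have hcard' : (Fintype.card T : ℝ) = 2 ^ d := by
    rw [Fintype.card_congr b.equivFun.toEquiv]
    simp
  have hsum : ∑ c : Fin d → ZMod 2, ‖inner ℂ ψ (weylApply (∑ i, c i • (b i : Phase n)) ψ)‖ ^ 2 =
      ∑ y : T, ‖ambiguity ψ y‖ ^ 2 := by
    rw [← Equiv.sum_comp b.equivFun.symm.toEquiv]
    refine Finset.sum_congr rfl fun c _ => ?_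
    rw [norm_inner_weylApply]
    congr 3
    simp [Module.Basis.equivFun_symm_apply]
  have hle : ∑ y : T, ‖ambiguity ψ y‖ ^ 4 ≤ ∑ y : T, ‖ambiguity ψ y‖ ^ 2 := by
    refine Finset.sum_le_sum fun y _ => ?_
    have : ‖ambiguity ψ y‖ ≤ 1 := by
      rw [← norm_inner_weylApply]
      refine (norm_inner_le_norm _ _).trans ?_
      rw [norm_weylApply, hψ, one_mul]
    exact pow_le_pow_of_le_one (norm_nonneg _) this (by norm_num)
  have hμφ : μ ≤ ‖φ‖ ^ 2 := by
    rw [hsum, hψ, ← hcard'] at h4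
    have : μ * (Fintype.card T : ℝ) ≤ ‖φ‖ ^ 2 * Fintype.card T := by linarith
    exact le_of_mul_le_mul_right this hcard
  have hφ : 0 < ‖φ‖ := by
    by_contra h0
    have : ‖φ‖ = 0 := le_antisymm (not_lt.1 h0) (norm_nonneg _)
    rw [this] at hμφ
    norm_num at hμφ
    linarith
  -- Since ⟨φ|ψ⟩ = ‖φ‖², the normalized projection has fidelity exactly ‖φ‖² with ψ.
  refine ⟨((‖φ‖⁻¹ : ℝ) : ℂ) • φ, ?_, ?_, ?_⟩
  · rw [norm_smul, Complex.norm_real, norm_inv, norm_norm, inv_mul_cancel₀ hφ.ne']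
  · have hT : T ≤ Submodule.span (ZMod 2) (weylGroup (((‖φ‖⁻¹ : ℝ) : ℂ) • φ)) := by
      have : T = Submodule.map T.subtype (Submodule.span (ZMod 2) (Set.range b)) := by
        rw [b.span_eq]; simp
      rw [this, Submodule.map_span_le]
      rintro _ ⟨i, rfl⟩
      refine Submodule.subset_span ?_
      rcases h1 i with hi | hi
      · left
        simp [weylApply_smul, hi]
      · right
        simp [weylApply_smul, hi]
    exact Submodule.finrank_mono hT
  · rw [fidelity, inner_smul_right, ← inner_conj_symm, h3, norm_mul, RCLike.norm_conj,
      Complex.norm_real, Complex.norm_real, norm_inv, norm_norm, norm_pow, norm_norm]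
    have : ‖φ‖⁻¹ * ‖φ‖ ^ 2 = ‖φ‖ := by field_simp
    rw [this]
    exact hμφ

end StabTest

namespace StabTest

/-! ### Analysis of the algorithm -/

variable {n : ℕ}

theorem outcomeProb_samples_eq {m : ℕ} (ψ : Qubits n) (x : Fin m → Phase n) :
    outcomeProb ψ (fun ω => samples ω = x) = ∏ i, bellDiffDist ψ (x i) := by
  classical
  have h : ∀ z : Phase n, bellDiffDist ψ z = ∑ p : Phase n × Phase n,
      if p.1 + p.2 = z then bellProb ψ p.1 * bellProb ψ p.2 else 0 := by
    intro z
    rw [Fintype.sum_prod_type, ← conv_bellProb, conv]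
    refine Finset.sum_congr rfl fun a _ => ?_
    symm
    have hz : a + (z + a) = z := by rw [add_comm z, ← add_assoc, phase_add_self, zero_add]
    refine (Fintype.sum_eq_single (z + a) fun b hb => if_neg ?_).trans (if_pos hz)
    rintro rfl
    apply hb
    rw [add_comm a, add_assoc, phase_add_self, add_zero]
  simp only [h]
  rw [Finset.prod_univ_sum, Fintype.piFinset_univ, outcomeProb]
  refine Finset.sum_congr rfl fun ω _ => ?_
  rw [Finset.prod_ite_zero]
  simp only [samples, funext_iff, Finset.mem_univ, true_imp_iff]

theorem outcomeProb_samples {m : ℕ} (ψ : Qubits n) (E : (Fin m → Phase n) → Prop)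
    [DecidablePred E] :
    outcomeProb ψ (fun ω => E (samples ω)) =
      ∑ x, if E x then ∏ i, bellDiffDist ψ (x i) else 0 := by
  have h : ∀ x : Fin m → Phase n, (if E x then ∏ i, bellDiffDist ψ (x i) else 0) =
      ∑ ω : Outcomes n m, if samples ω = x then
        (if E (samples ω) then ∏ i, bellProb ψ (ω i).1 * bellProb ψ (ω i).2 else 0) else 0 := by
    intro x
    rw [← outcomeProb_samples_eq, outcomeProb]
    split_ifs with hx
    · refine Finset.sum_congr rfl fun ω _ => ?_
      by_cases hω : samples ω = x
      · rw [if_pos hω, if_pos hω, if_pos (hω ▸ hx)]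
      · rw [if_neg hω, if_neg hω]
    · refine (Finset.sum_eq_zero fun ω _ => ?_).symm
      by_cases hω : samples ω = x
      · rw [if_pos hω, if_neg (hω ▸ hx)]
      · rw [if_neg hω]
  simp only [h]
  rw [Finset.sum_comm, outcomeProb]
  refine Finset.sum_congr rfl fun ω _ => ?_
  rw [Finset.sum_ite_eq, if_pos (Finset.mem_univ _)]
  congr

theorem sum_prod_bellDiffDist {ψ : Qubits n} (hψ : ‖ψ‖ = 1) (m : ℕ) :
    ∑ x : Fin m → Phase n, ∏ i, bellDiffDist ψ (x i) = 1 := by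
  have h := Finset.prod_univ_sum (fun _ : Fin m => (Finset.univ : Finset (Phase n)))
    (fun _ x => bellDiffDist ψ x)
  rw [Fintype.piFinset_univ] at h
  rw [← h]
  simp [sum_bellDiffDist hψ]

theorem returnValue_eq_one_iff {m k : ℕ} {x : Fin m → Phase n} : returnValue k x = 1 ↔
    k ≤ 2 * n - Module.finrank (ZMod 2) (Submodule.span (ZMod 2) (Set.range x)) := by
  unfold returnValue
  split_ifs with h <;> simp [h]

theorem returnValue_eq_zero_iff {m k : ℕ} {x : Fin m → Phase n} :
    returnValue k x = 0 ↔ ¬ returnValue k x = 1 := by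
  unfold returnValue
  split_ifs with h <;> simp

/-- Determinism makes the run found in `exec_stabDimTester` the only one, so events about the
program become events about the samples. -/
theorem returns_iff {m k : ℕ} (ω : Outcomes n m) (r : ℕ) :
    Returns stabDimTester k ω r ↔ returnValue k (samples ω) = r := by
  obtain ⟨s, t, e, h, -, -⟩ := exec_stabDimTester k ω
  constructor
  · rintro ⟨s', t', e', h'⟩
    obtain ⟨rfl, -⟩ := e.deterministic e'
    rw [← h, h']
  · rintro rfl
    exact ⟨s, t, e, h⟩

theorem returnValue_eq_one_of_le_stabDim {m k : ℕ} {ψ : Qubits n} (hψ : ‖ψ‖ = 1)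
    (hk : k ≤ stabDim ψ) {x : Fin m → Phase n} (hx : ∏ i, bellDiffDist ψ (x i) ≠ 0) :
    returnValue k x = 1 := by
  rw [returnValue_eq_one_iff]
  have hle : Submodule.span (ZMod 2) (Set.range x) ≤
      perp (Submodule.span (ZMod 2) (weylGroup ψ)) := by
    rw [Submodule.span_le]
    rintro _ ⟨i, rfl⟩
    have hi : bellDiffDist ψ (x i) ≠ 0 := Finset.prod_ne_zero_iff.1 hx i (Finset.mem_univ i)
    have : Submodule.span (ZMod 2) (weylGroup ψ) ≤ LinearMap.ker (symp n (x i)) := by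
      rw [Submodule.span_le]
      intro y hy
      exact symp_eq_zero_of_mem_weylGroup hψ hy hi
    exact mem_perp.2 fun y hy => by rw [symp_comm]; exact this hy
  have h := Submodule.finrank_mono hle
  rw [finrank_perp] at h
  have h' := finrank_le (Submodule.span (ZMod 2) (weylGroup ψ))
  unfold stabDim at hk
  omega

/-- Otherwise the complement of the span, of dimension at least k, has average |A|⁴ above 1 - ε >
5/8, and `exists_fidelity_ge` yields a state that is too close. This is where ε < 3/8 enters. -/
theorem mass_span_le {m k : ℕ} {ψ : Qubits n} (hψ : ‖ψ‖ = 1) {ε : ℝ} (hε : ε < 3 / 8)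
    (hfar : ∀ φ : Qubits n, ‖φ‖ = 1 → k ≤ stabDim φ → fidelity ψ φ ≤ 1 - ε)
    {x : Fin m → Phase n} (hx : returnValue k x = 1) :
    mass (bellDiffDist ψ) (Submodule.span (ZMod 2) (Set.range x)) ≤ 1 - ε := by
  classical
  rw [returnValue_eq_one_iff, ← finrank_perp] at hx
  by_contra! hlt
  set S := Submodule.span (ZMod 2) (Set.range x)
  have h := sum_bellDiffDist_perp ψ (perp S)
  rw [perp_perp] at h
  obtain ⟨φ, h1, h2, h3⟩ := exists_fidelity_ge hψ (perp S) (μ := mass (bellDiffDist ψ) S)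
    (by linarith) (by rw [mul_comm]; exact h.le)
  have := hfar φ h1 (hx.trans h2)
  linarith

/-- Use 1 - ε/2 ≤ exp(-ε/2) and 4^n ≤ exp(2n). Rounding m down costs at most ε/2 in the exponent,
which the spare 2n absorbs because n ≥ 1. -/
theorem four_pow_mul_pow_sampleCount_le {ε δ : ℝ} (hn : 1 ≤ n) (hε : 0 < ε) (hε' : ε < 3 / 8)
    (hδ : 0 < δ) : 2 ^ (2 * n) * (1 - ε / 2) ^ sampleCount n ε δ ≤ δ := by
  set m := sampleCount n ε δ
  have hm : (2 * Real.log (1 / δ) + 8 * n) / ε < m + 1 := Nat.lt_floor_add_one _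
  rw [div_lt_iff₀ hε, one_div, Real.log_inv] at hm
  have hn' : (1 : ℝ) ≤ n := by exact_mod_cast hn
  have h1 : (1 - ε / 2) ^ m ≤ Real.exp (-(m * (ε / 2))) := by
    rw [← mul_neg, Real.exp_nat_mul]
    refine pow_le_pow_left₀ (by linarith) ?_ m
    linarith [Real.add_one_le_exp (-(ε / 2))]
  have h2 : (2 : ℝ) ^ (2 * n) ≤ Real.exp (2 * n) := by
    have := Real.exp_nat_mul 1 (2 * n)
    rw [mul_one] at this
    push_cast at this
    rw [this]
    refine pow_le_pow_left₀ (by norm_num) ?_ _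
    linarith [Real.add_one_le_exp (1 : ℝ)]
  calc _ ≤ Real.exp (2 * n) * Real.exp (-(m * (ε / 2))) := by
        have : 0 ≤ 1 - ε / 2 := by linarith
        gcongr
    _ = Real.exp (2 * n - m * (ε / 2)) := by rw [← Real.exp_add, sub_eq_add_neg]
    _ ≤ Real.exp (Real.log δ) := Real.exp_le_exp.2 (by linarith)
    _ = δ := Real.exp_log hδ

theorem le_outcomeProb_returnValue_zero {k : ℕ} {ψ : Qubits n} (hψ : ‖ψ‖ = 1) (hn : 1 ≤ n)
    {ε δ : ℝ} (hε : 0 < ε) (hε' : ε < 3 / 8) (hδ : 0 < δ)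
    (hfar : ∀ φ : Qubits n, ‖φ‖ = 1 → k ≤ stabDim φ → fidelity ψ φ ≤ 1 - ε) :
    1 - δ ≤ outcomeProb ψ
      (fun ω : Outcomes n (sampleCount n ε δ) => returnValue k (samples ω) = 0) := by
  rw [outcomeProb_samples ψ fun x => returnValue k x = 0]
  have h1 := sum_span_mass_le (bellDiffDist_nonneg ψ) (sum_bellDiffDist hψ) (ε := ε) (by linarith)
    (sampleCount n ε δ) ⊥
  simp only [bot_sup_eq, finrank_bot, pow_zero, div_one, finrank_phase] at h1
  have h2 := h1.trans (four_pow_mul_pow_sampleCount_le hn hε hε' hδ)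
  have h3 := sum_prod_bellDiffDist hψ (sampleCount n ε δ)
  -- Each sequence of samples gives the answer 0 or has a span of mass at most 1 - ε.
  have h4 : ∑ x : Fin (sampleCount n ε δ) → Phase n, ∏ i, bellDiffDist ψ (x i) ≤
      ∑ x : Fin (sampleCount n ε δ) → Phase n, (if returnValue k x = 0 then ∏ i, bellDiffDist ψ (x i) else 0) +
      ∑ x : Fin (sampleCount n ε δ) → Phase n,
        (if mass (bellDiffDist ψ) (Submodule.span (ZMod 2) (Set.range x)) ≤ 1 - ε
          then ∏ i, bellDiffDist ψ (x i) else 0) := by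
    rw [← Finset.sum_add_distrib]
    refine Finset.sum_le_sum fun x _ => ?_
    have hnn : 0 ≤ ∏ i, bellDiffDist ψ (x i) :=
      Finset.prod_nonneg fun i _ => bellDiffDist_nonneg ψ _
    by_cases hx : returnValue k x = 1
    · rw [if_pos (mass_span_le hψ hε' hfar hx)]
      split_ifs <;> linarith
    · rw [if_pos (returnValue_eq_zero_iff.2 hx)]
      split_ifs <;> linarith
  linarith

theorem outcomeProb_returnValue_one {m k : ℕ} {ψ : Qubits n} (hψ : ‖ψ‖ = 1)
    (hk : k ≤ stabDim ψ) :
    outcomeProb ψ (fun ω : Outcomes n m => returnValue k (samples ω) = 1) = 1 := by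
  rw [outcomeProb_samples ψ fun x => returnValue k x = 1, ← sum_prod_bellDiffDist hψ m]
  refine Finset.sum_congr rfl fun x _ => ?_
  by_cases hx : ∏ i, bellDiffDist ψ (x i) = 0
  · simp [hx]
  · rw [if_pos (returnValue_eq_one_of_le_stabDim hψ hk hx)]

theorem sampleCount_mul_le {ε δ : ℝ} (hε : 0 < ε) (hδ : 0 < δ) (hδ' : δ ≤ 1) :
    (sampleCount n ε δ : ℝ) ≤ (2 * Real.log (1 / δ) + 8 * n) / ε := by
  refine Nat.floor_le ?_
  have : 0 ≤ Real.log (1 / δ) := Real.log_nonneg (by rw [le_div_iff₀ hδ]; linarith)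
  positivity

/-- For n ≥ 1 the cost per sample is at most 60n² and the overhead at most 13n³/ε, so 493 = 8·60 +
13. -/
theorem steps_le {ε δ : ℝ} (hn : 1 ≤ n) (hε : 0 < ε) (hε' : ε < 3 / 8) (hδ : 0 < δ) (hδ' : δ ≤ 1)
    {t : ℕ} (ht : t ≤ sampleCount n ε δ * (24 * n ^ 2 + 28 * n + 8) + 4 * n + 9) :
    (t : ℝ) ≤ 493 * (((n : ℝ) ^ 3 + (n : ℝ) ^ 2 * Real.log (1 / δ)) / ε) := by
  have hL : 0 ≤ Real.log (1 / δ) := Real.log_nonneg (by rw [le_div_iff₀ hδ]; linarith)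
  have hm := sampleCount_mul_le (n := n) hε hδ hδ'
  set L := Real.log (1 / δ)
  set m := sampleCount n ε δ
  have hn' : (1 : ℝ) ≤ n := by exact_mod_cast hn
  have ht' : (t : ℝ) ≤ m * (24 * (n : ℝ) ^ 2 + 28 * n + 8) + 4 * n + 9 := by exact_mod_cast ht
  have h1 : (m : ℝ) * (24 * (n : ℝ) ^ 2 + 28 * n + 8) ≤
      (2 * L + 8 * n) / ε * (60 * (n : ℝ) ^ 2) :=
    mul_le_mul hm (by nlinarith) (by positivity) (by positivity)
  have h2 : 4 * (n : ℝ) + 9 ≤ 13 * (n : ℝ) ^ 3 / ε := by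
    rw [le_div_iff₀ hε]
    have h3 : (n : ℝ) ≤ (n : ℝ) ^ 3 := le_self_pow₀ hn' (by norm_num)
    nlinarith
  calc (t : ℝ) ≤ (2 * L + 8 * n) / ε * (60 * (n : ℝ) ^ 2) + 13 * (n : ℝ) ^ 3 / ε := by linarith
    _ = (493 * (n : ℝ) ^ 3 + 120 * ((n : ℝ) ^ 2 * L)) / ε := by ring
    _ ≤ (493 * (n : ℝ) ^ 3 + 493 * ((n : ℝ) ^ 2 * L)) / ε := by gcongr; norm_num
    _ = _ := by ring

end StabTest

open StabTest
theorem mainTheorem2 :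
    ∃ (P : Prog) (C : ℝ), ∀ (n k : ℕ) (ε δ : ℝ), 1 ≤ k → k ≤ n → 0 < ε → ε < 3 / 8 → 0 < δ → δ ≤ 1 →
      -- on all measurement outcomes `P` carries out the algorithm, within the claimed resources
      (∀ ω : Outcomes n (sampleCount n ε δ), ∃ (s : Config n) (t : ℕ),
        Exec P (initial k ω) s t ∧
        s.reg 0 = returnValue k (samples ω) ∧
        s.copies = 4 * sampleCount n ε δ ∧
        (s.copies : ℝ) ≤ (32 * n + 8 * Real.log (1 / δ)) / ε ∧
        (t : ℝ) ≤ C * (((n : ℝ) ^ 3 + (n : ℝ) ^ 2 * Real.log (1 / δ)) / ε)) ∧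
      ∀ ψ : Qubits n, ‖ψ‖ = 1 →
        -- the samples are independent draws from `q_ψ`
        (∀ x : Fin (sampleCount n ε δ) → Phase n,
          outcomeProb ψ (fun ω => samples ω = x) = ∏ i, bellDiffDist ψ (x i)) ∧
        (k ≤ stabDim ψ →
          outcomeProb ψ (fun ω : Outcomes n (sampleCount n ε δ) => Returns P k ω 1) = 1) ∧
        ((∀ φ : Qubits n, ‖φ‖ = 1 → k ≤ stabDim φ → fidelity ψ φ ≤ 1 - ε) →
          1 - δ ≤ outcomeProb ψ (fun ω : Outcomes n (sampleCount n ε δ) => Returns P k ω 0)) := by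
  refine ⟨stabDimTester, 493, fun n k ε δ hk hkn hε hε' hδ hδ' => ⟨fun ω => ?_, fun ψ hψ =>
    ⟨outcomeProb_samples_eq ψ, fun hdim => ?_, fun hfar => ?_⟩⟩⟩
  · obtain ⟨s, t, e, h0, hc, ht⟩ := exec_stabDimTester k ω
    refine ⟨s, t, e, h0, hc, ?_, steps_le (hk.trans hkn) hε hε' hδ hδ' ht⟩
    have := sampleCount_mul_le (n := n) hε hδ hδ'
    rw [hc]
    push_cast
    calc _ ≤ 4 * ((2 * Real.log (1 / δ) + 8 * n) / ε) := by linarith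
      _ = _ := by ring
  · simp only [returns_iff]
    exact outcomeProb_returnValue_one hψ hdim
  · simp only [returns_iff]
    exact le_outcomeProb_returnValue_zero hψ (hk.trans hkn) hε hε' hδ hfar
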